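/- **Setting.** Let $\ell\ge 1$, let $\mathcal X$ be an arbitrary set, $n\in\mathbb N$, $\mathcal Y=[0,1]^\ell$ and $F:\mathcal X^n\times\mathcal Y\to\mathbb R$; write $F_{\mathcal D}=F(\mathcal D,\cdot)$. Write $\mathcal D\sim\mathcal D'$ if $\mathcal D,\mathcal D'\in\mathcal X^n$ differ in exactly one entry, and let $S(F)=\sup_{y\in\mathcal Y}\sup_{\mathcal D\sim\mathcal D'}|F_{\mathcal D}(y)-F_{\mathcal D'}(y)|$. For a positive integer $m$ and $T>0$, a function $f:[0,1]^\ell\to\mathbb R$ is $(m,T)$-smooth if it is $C^m$ on the closed cube and its partial derivatives of orders $1,\dots,m$ are bounded by $T$ in absolute value; for $0<\gamma\le1$, $L>0$ it is $(\gamma,L)$-Hölder if $|f(x)-f(y)|\le L\|x-y\|_\infty^\gamma$ for all $x,y\in[0,1]^\ell$. For positive integers $k,h$ let $b_{\nu,k}(y)=\binom k\nu y^\nu(1-y)^{k-\nu}$, $B_kf(y)=\sum_{\nu=0}^kf(\nu/k)\,b_{\nu,k}(y)$ and $b^{(h)}_{\nu,k}=\sum_{i=1}^h\binom hi(-1)^{i-1}B_k^{\,i-1}b_{\nu,k}$.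 The Bernstein mechanism with cover size $k$, order $h$ and perturbation scale $\lambda$ releases, on input $\mathcal D$, the values $a_\nu=F_{\mathcal D}(\nu/k)+Z_\nu$ for $\nu\in\{0,\dots,k\}^\ell$, where the $Z_\nu$ are i.i.d. Laplace with density $\frac1{2\lambda}e^{-|x|/\lambda}$ ($Z_\nu=0$ if $\lambda=0$); a query $y\in\mathcal Y$ is answered by $\mathcal A(y)=\sum_{\nu}a_\nu\prod_{i=1}^\ell b^{(h)}_{\nu_i,k}(y_i)$. It is $(\varepsilon,\delta)$-differentially private if $\Pr[a(\mathcal D)\in A]\le e^\varepsilon\Pr[a(\mathcal D')\in A]+\delta$ for all $\mathcal D\sim\mathcal D'$ and all measurable $A$, and $(\alpha,\beta)$-accurate if for every $\mathcal D$, with probability at least $1-\beta$, $\sup_{y\in\mathcal Y}|\mathcal A(y)-F_{\mathcal D}(y)|\le\alpha$. **Theorem.** Let $\varepsilon>0$, $0<\delta<1$, and use the perturbation scale $$\lambda_\delta=\frac{2S(F)\sqrt{2(k+1)^\ell\log(1/\delta)}}{\varepsilon}.$$ 1. (Privacy.) If $S(F)<\infty$ and $\varepsilon\le 8\log(1/\delta)$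 (for instance $\varepsilon\le1$ and $\delta\le 1/2$), then for every $k\ge1$ the mechanism is $(\varepsilon,\delta)$-differentially private. For $0<S(F)<\infty$ and $0<\beta<1$ put $r=\frac{S(F)}{\varepsilon}\log(1/\beta)\sqrt{\log(1/\delta)}$. Fix $\beta_0<1$ and $K$, and suppose $\beta\le\beta_0$ and $r\le K$ (the regime of small sensitivity; for instance $K=1$). All values of $\varepsilon>0$ and $0<\delta<1$ are allowed in 2 and 3. 2. (Smooth case.) For all $h\ge1$ and $T>0$ there is a choice $k=k(S(F),\varepsilon,\delta,\beta,\ell,h,T)\ge1$ such that, if $F_{\mathcal D}$ is $(2h,T)$-smooth for every $\mathcal D\in\mathcal X^n$, the mechanism of order $h$ with cover size $k$ is $(\alpha,\beta)$-accurate with $\alpha=C\,r^{2h/(\ell+2h)}$, where $C$ depends only on $\ell,h,T,\beta_0,K$. 3. (Hölder case.) For all $0<\gamma\le1$ and $L>0$ there is a choice $k=k(S(F),\varepsilon,\delta,\beta,\ell,\gamma,L)\ge1$ such that, for every order $h\ge1$, if $F_{\mathcal D}$ is $(\gamma,L)$-Hölder for every $\mathcal D\in\mathcal X^n$, the mechanism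 of order $h$ with cover size $k$ is $(\alpha,\beta)$-accurate with $\alpha=C\,r^{\gamma/(\ell+\gamma)}$, where $C$ depends only on $\ell,h,\gamma,L,\beta_0,K$. -/

import Mathlib

open MeasureTheory Set
open scoped ENNReal

noncomputable section

namespace BernsteinMechanism

/-- The query space `[0,1]^l`. All notions below look at functions on this cube only. -/
def cube (l : ℕ) : Set (Fin l → ℝ) := Icc 0 1

/-! ### Regularity of functions on the cube -/

/-- `f` is `C^m` on the closed cube and all its partial derivatives of orders `1, …, m`
are bounded by `T` there. The `j`-th order partial derivative in the coordinate directions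
`i 0, …, i (j - 1)` is the `j`-th derivative evaluated at the corresponding basis vectors. -/
def IsSmooth {l : ℕ} (m : ℕ) (T : ℝ) (f : (Fin l → ℝ) → ℝ) : Prop :=
  ContDiffOn ℝ m f (cube l) ∧
    ∀ j : ℕ, 1 ≤ j → j ≤ m → ∀ i : Fin j → Fin l, ∀ y ∈ cube l,
      |iteratedFDerivWithin ℝ j f (cube l) y (fun s => Pi.single (i s) 1)| ≤ T

/-- `(γ, L)`-Hölder continuity on the cube; the norm on `Fin l → ℝ` is the sup norm. -/
def IsHolder {l : ℕ} (γ L : ℝ) (f : (Fin l → ℝ) → ℝ) : Prop :=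
  ∀ x ∈ cube l, ∀ y ∈ cube l, |f x - f y| ≤ L * ‖x - y‖ ^ γ

/-! ### Databases, sensitivity, differential privacy, accuracy -/

/-- Two databases of size `n` that differ in one entry only. -/
def Neighbors {X : Type*} {n : ℕ} (D D' : Fin n → X) : Prop :=
  ∃ i, D i ≠ D' i ∧ ∀ j, j ≠ i → D j = D' j

/-- Sensitivity of a real-valued function of the database (possibly infinite). -/
def pointSensitivity {X : Type*} {n : ℕ} (f : (Fin n → X) → ℝ) : ℝ≥0∞ :=
  ⨆ (D : Fin n → X) (D' : Fin n → X) (_ : Neighbors D D'), ENNReal.ofReal |f D - f D'|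

/-- Sensitivity of a function-valued map `F`: the supremum over the cube of the
sensitivities of `F(·, y)`. -/
def sensitivity {X : Type*} {n l : ℕ} (F : (Fin n → X) → (Fin l → ℝ) → ℝ) : ℝ≥0∞ :=
  ⨆ y ∈ cube l, pointSensitivity (fun D => F D y)

/-- `(ε, δ)`-differential privacy of a mechanism, given by the law `M D` of its response
on each database `D` of size `n`. -/
def IsDifferentiallyPrivate {X R : Type*} [MeasurableSpace R] {n : ℕ}
    (M : (Fin n → X) → Measure R) (ε δ : ℝ) : Prop :=
  ∀ D D' : Fin n → X, Neighbors D D' → ∀ A : Set R, MeasurableSet A →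
    M D A ≤ ENNReal.ofReal (Real.exp ε) * M D' A + ENNReal.ofReal δ

/-- `(α, β)`-accuracy: for every database `D`, with probability at least `1 - β` over the
response `a` of the mechanism, the function `eval a` is within `α` of `F D` on the cube. -/
def IsAccurate {X R : Type*} [MeasurableSpace R] {n l : ℕ}
    (M : (Fin n → X) → Measure R) (eval : R → (Fin l → ℝ) → ℝ)
    (F : (Fin n → X) → (Fin l → ℝ) → ℝ) (α β : ℝ) : Prop :=
  ∀ D : Fin n → X,
    ENNReal.ofReal (1 - β) ≤ M D {a | ∀ y ∈ cube l, |eval a y - F D y| ≤ α}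

/-! ### Iterated Bernstein polynomials -/

/-- Bernstein basis polynomial `b_{ν,k}(y) = (k choose ν) y^ν (1-y)^(k-ν)`. -/
def basis (k ν : ℕ) (y : ℝ) : ℝ := (k.choose ν : ℝ) * y ^ ν * (1 - y) ^ (k - ν)

/-- Bernstein operator `B_k`. -/
def bernsteinOp (k : ℕ) (f : ℝ → ℝ) (y : ℝ) : ℝ :=
  ∑ ν ∈ Finset.range (k + 1), f ((ν : ℝ) / (k : ℝ)) * basis k ν y

/-- Basis functions of the iterated Bernstein operator of order `h`:
`b^{(h)}_{ν,k} = ∑_{i=1}^h (h choose i) (-1)^(i-1) B_k^{i-1}(b_{ν,k})`. -/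
def iteratedBasis (h k ν : ℕ) (y : ℝ) : ℝ :=
  ∑ i ∈ Finset.Icc 1 h,
    (h.choose i : ℝ) * (-1) ^ (i - 1) * ((bernsteinOp k)^[i - 1] (basis k ν)) y

/-! ### The mechanism -/

/-- Index set of the lattice `{0, 1/k, …, 1}^l`. -/
abbrev Lattice (l k : ℕ) : Type := Fin l → Fin (k + 1)

/-- The lattice point with index `ν`. -/
def latticePoint {l k : ℕ} (ν : Lattice l k) : Fin l → ℝ :=
  fun i => ((ν i : ℕ) : ℝ) / (k : ℝ)

/-- Centred Laplace distribution with scale `b`; the point mass at `0` for `b = 0`. -/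
def laplace (b : ℝ) : Measure ℝ :=
  if b = 0 then Measure.dirac 0
  else volume.withDensity (fun x => ENNReal.ofReal (Real.exp (-|x| / b) / (2 * b)))

/-- Sanitization step of the Bernstein mechanism with cover size `k` and perturbation scale
`b`: the law of the lattice evaluations of `F D` with i.i.d. Laplace noise of scale `b`. -/
def mechanism {X : Type*} {n l : ℕ} (F : (Fin n → X) → (Fin l → ℝ) → ℝ) (k : ℕ) (b : ℝ)
    (D : Fin n → X) : Measure (Lattice l k → ℝ) :=
  (Measure.pi (fun _ : Lattice l k => laplace b)).map
    (fun Z ν => F D (latticePoint ν) + Z ν)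

/-- Evaluation step of the Bernstein mechanism of order `h`: the multivariate iterated
Bernstein polynomial with the released coefficients `a`. -/
def evaluate {l k : ℕ} (h : ℕ) (a : Lattice l k → ℝ) (y : Fin l → ℝ) : ℝ :=
  ∑ ν : Lattice l k, a ν * ∏ i, iteratedBasis h k (ν i) (y i)

/-- The perturbation scale `λ_δ = 2 S √(2 (k+1)^l log(1/δ)) / ε`. -/
def scale (l k : ℕ) (S ε δ : ℝ) : ℝ :=
  2 * S * √(2 * ((k : ℝ) + 1) ^ l * Real.log (1 / δ)) / ε

/-- The quantity `(S/ε) log(1/β) √(log(1/δ))` whose powers are the error rates. -/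
def rateBase (S ε δ β : ℝ) : ℝ :=
  S / ε * Real.log (1 / β) * √(Real.log (1 / δ))

end BernsteinMechanism

end

open BernsteinMechanism

universe u

namespace BernsteinMechanism

/-! ### Bernstein basis polynomials -/

/-! Privacy. The released vector is a product of `(k+1)^l` shifted Laplace laws, and on each
coordinate the privacy loss between neighbouring databases is bounded by `e = S/b`, where `b` is the
noise scale. Its exponential moment at `-1` equals 1, so Hoeffding's lemma bounds its mean by
`e²/2`. Hoeffding's inequality for the total loss then gives advanced composition
(`pi_le_exp_mul_pi_add`), and the scale is tuned so that the tail beyond `ε` is at most `δ`.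

Accuracy. By linearity the error is an approximation error plus the iterated Bernstein polynomial of
the noise.

Approximation. In one variable the error operator of order `h` is `(1 - B_k)^h`. On polynomials
every factor `1 - B_k` gains `1/k`, so the Taylor polynomial at `y` contributes `O(k^(-h))`; the
Taylor remainder is at most `T|x - y|^(2h)`, and the moments of the iterates `B_k^i` make its
contribution `O(k^(-h))` too (`exists_abs_one_sub_bernsteinEnd_pow_le`). For Hölder functions one
application of `1 - B_k` already gives `k^(-γ/2)`. On the cube, coordinatewise errors add up, each
coordinate costing a factor `2^h` (`abs_evaluate_sub_le`).

Noise. The maximum of all `|Z_ν|` would introduce a factor `log k`, which the rate does not allow.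
Instead, indices are grouped into blocks by the integer square root of their distance to the nearer
end of `{0, …, k}`. Bernstein weights are unimodal and of local size at most a constant over `√ν`,
so they have a majorant constant on blocks whose total mass is bounded uniformly in `k` and `y`
(`exists_label_majorant`). Hence only the averages of `|Z_ν|` over product cells matter
(`abs_evaluate_one_le_of_cell`). A cell of size `N` fails with probability `exp(-sN)`, and these sum
to `O(exp(-s))` uniformly in `k`, so all averages are `O(b log(1/β))` at once
(`le_pi_laplace_cell`). Passing from order 1 to order `h` again costs only `(2^h)^l`.

Finally `k ≈ r^(-2/(l+p))` balances an approximation error `k^(-p/2)` against noise `k^(l/2) r`,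
with `p = 2h` or `p = γ`. -/

theorem basis_nonneg {y : ℝ} (hy : y ∈ Icc (0 : ℝ) 1) (k ν : ℕ) : 0 ≤ basis k ν y := by
  have h0 := hy.1
  have h1 : 0 ≤ 1 - y := sub_nonneg.2 hy.2
  unfold basis
  positivity

theorem sum_pow_mul_basis (k : ℕ) (x y : ℝ) :
    ∑ ν ∈ Finset.range (k + 1), x ^ ν * basis k ν y = (1 - y + y * x) ^ k := by
  rw [add_comm (1 - y), add_pow]
  refine Finset.sum_congr rfl fun ν _ => ?_
  unfold basis
  rw [mul_pow]
  ring

theorem sum_basis (k : ℕ) (y : ℝ) : ∑ ν ∈ Finset.range (k + 1), basis k ν y = 1 := by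
  have h := sum_pow_mul_basis k 1 y
  simpa using h

/-- The binomial moment generating function is `(1 - y + y e^t)^k`, and `e^t ≤ 1 + t + t²` for `|t|
≤ 1` turns the base into at most `exp(yt + t²)`. -/
theorem sum_exp_mul_basis_le {k : ℕ} {y t : ℝ} (hy : y ∈ Icc (0 : ℝ) 1) (ht : |t| ≤ 1) :
    ∑ ν ∈ Finset.range (k + 1), Real.exp (t * ((ν : ℝ) - k * y)) * basis k ν y
      ≤ Real.exp (k * t ^ 2) := by
  have h1 : ∑ ν ∈ Finset.range (k + 1), Real.exp (t * ((ν : ℝ) - k * y)) * basis k ν y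
      = Real.exp (-(k * (y * t))) * (1 - y + y * Real.exp t) ^ k := by
    rw [← sum_pow_mul_basis, Finset.mul_sum]
    refine Finset.sum_congr rfl fun ν _ => ?_
    rw [← mul_assoc, ← Real.exp_nat_mul, ← Real.exp_add]
    congr 2
    ring
  have h2 : Real.exp t ≤ 1 + t + t ^ 2 := by
    have := Real.abs_exp_sub_one_sub_id_le ht
    have := (abs_le.1 this).2
    linarith
  have h3 : 1 - y + y * Real.exp t ≤ Real.exp (y * t + t ^ 2) := by
    have := Real.add_one_le_exp (y * t + t ^ 2)
    nlinarith [hy.1, hy.2, sq_nonneg t, mul_le_mul_of_nonneg_left h2 hy.1,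
      mul_le_mul_of_nonneg_right hy.2 (sq_nonneg t)]
  have h4 : 0 ≤ 1 - y + y * Real.exp t := by
    have := mul_nonneg hy.1 (Real.exp_pos t).le
    linarith [hy.2]
  rw [h1]
  calc _ ≤ Real.exp (-(k * (y * t))) * Real.exp (y * t + t ^ 2) ^ k := by gcongr
    _ = _ := by
      rw [← Real.exp_nat_mul, ← Real.exp_add]
      congr 1
      ring

theorem pow_div_factorial_le_exp_add_exp (m : ℕ) (z : ℝ) :
    z ^ (2 * m) / (2 * m).factorial ≤ Real.exp z + Real.exp (-z) := by
  have h := Real.pow_div_factorial_le_exp |z| (abs_nonneg z) (2 * m)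
  rw [pow_mul, sq_abs, ← pow_mul] at h
  rcases abs_cases z with ⟨h1, _⟩ | ⟨h1, _⟩ <;> rw [h1] at h
  · linarith [Real.exp_pos (-z)]
  · linarith [Real.exp_pos z]

/-- Even central moments of the binomial distribution. -/
theorem sum_pow_sub_mul_basis_le {k : ℕ} (hk : 0 < k) (m : ℕ) {y : ℝ}
    (hy : y ∈ Icc (0 : ℝ) 1) :
    ∑ ν ∈ Finset.range (k + 1), ((ν : ℝ) / k - y) ^ (2 * m) * basis k ν y
      ≤ 2 * Real.exp 1 * (2 * m).factorial * ((k : ℝ) ^ m)⁻¹ := by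
  have hk' : (0 : ℝ) < k := by exact_mod_cast hk
  have hk1 : (1 : ℝ) ≤ k := by exact_mod_cast hk
  -- This scale makes `k t² = 1`: both exponential moments are at most `e`, and `(t(ν - ky))^(2m)`
  -- equals `k^m (ν/k - y)^(2m)`.
  set t : ℝ := (√k)⁻¹ with ht
  have hs : 0 < √(k : ℝ) := Real.sqrt_pos.2 hk'
  have ht1 : |t| ≤ 1 := by
    rw [abs_of_pos (inv_pos.2 hs)]
    exact inv_le_one_of_one_le₀ (Real.one_le_sqrt.2 hk1)
  have htk : (k : ℝ) * t ^ 2 = 1 := by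
    rw [ht, inv_pow, Real.sq_sqrt hk'.le, mul_inv_cancel₀ hk'.ne']
  have e1 := sum_exp_mul_basis_le (k := k) hy ht1
  have e2 := sum_exp_mul_basis_le (k := k) (t := -t) hy (by rwa [abs_neg])
  rw [neg_sq, htk] at e2
  rw [htk] at e1
  have key : ∀ ν ∈ Finset.range (k + 1), ((ν : ℝ) / k - y) ^ (2 * m) * basis k ν y
      ≤ ((2 * m).factorial * ((k : ℝ) ^ m)⁻¹) *
        (Real.exp (t * ((ν : ℝ) - k * y)) * basis k ν y
          + Real.exp (-t * ((ν : ℝ) - k * y)) * basis k ν y) := by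
    intro ν _
    have h := pow_div_factorial_le_exp_add_exp m (t * ((ν : ℝ) - k * y))
    have hz : (t * ((ν : ℝ) - k * y)) ^ (2 * m) = (k : ℝ) ^ m * ((ν : ℝ) / k - y) ^ (2 * m) := by
      rw [pow_mul, pow_mul, ← mul_pow]
      congr 1
      have : (ν : ℝ) - k * y = k * ((ν : ℝ) / k - y) := by field_simp
      rw [this]
      linear_combination (k * ((ν : ℝ) / k - y) ^ 2) * htk
    rw [hz, div_le_iff₀ (by positivity)] at h
    rw [← add_mul, ← mul_assoc]
    refine mul_le_mul_of_nonneg_right ?_ (basis_nonneg hy k ν)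
    have hkm : (0 : ℝ) < (k : ℝ) ^ m := by positivity
    rw [neg_mul]
    calc ((ν : ℝ) / k - y) ^ (2 * m)
        = ((k : ℝ) ^ m)⁻¹ * ((k : ℝ) ^ m * ((ν : ℝ) / k - y) ^ (2 * m)) := by field_simp
      _ ≤ ((k : ℝ) ^ m)⁻¹ * ((Real.exp (t * ((ν : ℝ) - k * y))
          + Real.exp (-(t * ((ν : ℝ) - k * y)))) * (2 * m).factorial) := by gcongr
      _ = _ := by ring
  refine (Finset.sum_le_sum key).trans ?_
  rw [← Finset.mul_sum, Finset.sum_add_distrib]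
  calc _ ≤ ((2 * m).factorial * ((k : ℝ) ^ m)⁻¹) * (Real.exp 1 + Real.exp 1) := by gcongr
    _ = _ := by ring

/-! ### The Bernstein operator as a linear map -/

/-- The Bernstein operator as an endomorphism of the space of functions. -/
noncomputable def bernsteinEnd (k : ℕ) : Module.End ℝ (ℝ → ℝ) where
  toFun := bernsteinOp k
  map_add' f g := by
    ext y
    simp only [bernsteinOp, Pi.add_apply, add_mul, Finset.sum_add_distrib]
  map_smul' c f := by
    ext y
    simp only [bernsteinOp, Pi.smul_apply, smul_eq_mul, RingHom.id_apply, Finset.mul_sum, mul_assoc]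

theorem bernsteinEnd_apply (k : ℕ) (f : ℝ → ℝ) (y : ℝ) :
    bernsteinEnd k f y = ∑ ν ∈ Finset.range (k + 1), f ((ν : ℝ) / k) * basis k ν y := rfl

theorem bernsteinEnd_pow_apply (k i : ℕ) (f : ℝ → ℝ) :
    (bernsteinEnd k ^ i) f = (bernsteinOp k)^[i] f := by
  rw [Module.End.pow_apply]
  rfl

theorem node_mem_Icc {k ν : ℕ} (h : ν ∈ Finset.range (k + 1)) :
    ((ν : ℝ) / k) ∈ Icc (0 : ℝ) 1 := by
  refine ⟨by positivity, div_le_one_of_le₀ ?_ (by positivity)⟩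
  exact_mod_cast Nat.lt_succ_iff.1 (Finset.mem_range.1 h)

theorem bernsteinEnd_const (k : ℕ) (c : ℝ) : bernsteinEnd k (fun _ => c) = fun _ => c := by
  ext y
  rw [bernsteinEnd_apply, ← Finset.mul_sum, sum_basis, mul_one]

theorem bernsteinEnd_mono {k : ℕ} {f g : ℝ → ℝ} (h : ∀ z ∈ Icc (0 : ℝ) 1, f z ≤ g z) :
    ∀ z ∈ Icc (0 : ℝ) 1, bernsteinEnd k f z ≤ bernsteinEnd k g z := fun _ hz =>
  Finset.sum_le_sum fun ν hν =>
    mul_le_mul_of_nonneg_right (h _ (node_mem_Icc hν)) (basis_nonneg hz k ν)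

theorem bernsteinEnd_pow_mono {k : ℕ} {f g : ℝ → ℝ} (h : ∀ z ∈ Icc (0 : ℝ) 1, f z ≤ g z)
    (i : ℕ) : ∀ z ∈ Icc (0 : ℝ) 1, (bernsteinEnd k ^ i) f z ≤ (bernsteinEnd k ^ i) g z := by
  induction i with
  | zero => simpa using h
  | succ i ih =>
    rw [pow_succ']
    exact bernsteinEnd_mono ih

theorem bernsteinEnd_pow_const (k i : ℕ) (c : ℝ) :
    (bernsteinEnd k ^ i) (fun _ => c) = fun _ => c := by
  induction i with
  | zero => simp
  | succ i ih => rw [pow_succ', Module.End.mul_apply, ih, bernsteinEnd_const]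

theorem abs_bernsteinEnd_pow_le {k : ℕ} {f g : ℝ → ℝ} (h : ∀ z ∈ Icc (0 : ℝ) 1, |f z| ≤ g z)
    (i : ℕ) : ∀ z ∈ Icc (0 : ℝ) 1, |(bernsteinEnd k ^ i) f z| ≤ (bernsteinEnd k ^ i) g z := by
  intro z hz
  rw [abs_le]
  refine ⟨?_, bernsteinEnd_pow_mono (fun w hw => (abs_le.1 (h w hw)).2) i z hz⟩
  have := bernsteinEnd_pow_mono (k := k) (f := -g) (g := f) (fun w hw => (abs_le.1 (h w hw)).1) i z hz
  rwa [map_neg] at this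

theorem abs_bernsteinEnd_pow_le_const {k : ℕ} {f : ℝ → ℝ} {M : ℝ}
    (h : ∀ z ∈ Icc (0 : ℝ) 1, |f z| ≤ M) (i : ℕ) :
    ∀ z ∈ Icc (0 : ℝ) 1, |(bernsteinEnd k ^ i) f z| ≤ M := by
  intro z hz
  have := abs_bernsteinEnd_pow_le (k := k) h i z hz
  rwa [bernsteinEnd_pow_const] at this

theorem one_sub_bernsteinEnd_pow (k h : ℕ) :
    (1 - bernsteinEnd k) ^ h =
      ∑ i ∈ Finset.range (h + 1), ((-1) ^ i * (h.choose i : ℝ)) • bernsteinEnd k ^ i := by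
  rw [sub_eq_neg_add, Commute.add_pow (Commute.one_right _)]
  refine Finset.sum_congr rfl fun i _ => ?_
  rw [one_pow, mul_one, ← neg_one_smul ℝ (bernsteinEnd k), smul_pow, mul_comm ((-1 : ℝ) ^ i),
    mul_smul, ← Nat.cast_comm, ← nsmul_eq_mul, Nat.cast_smul_eq_nsmul]

theorem one_sub_bernsteinEnd_pow_apply (k h : ℕ) (f : ℝ → ℝ) (y : ℝ) :
    ((1 - bernsteinEnd k) ^ h) f y =
      ∑ i ∈ Finset.range (h + 1), ((-1) ^ i * (h.choose i : ℝ)) * (bernsteinEnd k ^ i) f y := by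
  rw [one_sub_bernsteinEnd_pow]
  simp [LinearMap.sum_apply, Finset.sum_apply]

theorem sum_mul_iteratedBasis (h k : ℕ) (c : ℕ → ℝ) (y : ℝ) :
    ∑ ν ∈ Finset.range (k + 1), c ν * iteratedBasis h k ν y =
      ∑ i ∈ Finset.Icc 1 h, (h.choose i : ℝ) * (-1) ^ (i - 1) *
        (bernsteinEnd k ^ (i - 1)) (fun z => ∑ ν ∈ Finset.range (k + 1), c ν * basis k ν z) y := by
  have h1 : (fun z => ∑ ν ∈ Finset.range (k + 1), c ν * basis k ν z)
      = ∑ ν ∈ Finset.range (k + 1), c ν • basis k ν := by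
    ext z
    simp [Finset.sum_apply]
  simp only [h1, map_sum, map_smul, Finset.sum_apply, Pi.smul_apply, smul_eq_mul, iteratedBasis,
    ← bernsteinEnd_pow_apply, Finset.mul_sum]
  rw [Finset.sum_comm]
  exact Finset.sum_congr rfl fun _ _ => Finset.sum_congr rfl fun _ _ => by ring

theorem sum_choose_Icc_le (h : ℕ) : ∑ i ∈ Finset.Icc 1 h, (h.choose i : ℝ) ≤ 2 ^ h := by
  have h1 : ∑ i ∈ Finset.range (h + 1), (h.choose i : ℝ) = 2 ^ h := by
    exact_mod_cast Nat.sum_range_choose h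
  rw [← h1]
  refine Finset.sum_le_sum_of_subset_of_nonneg (fun i hi => ?_) fun _ _ _ => by positivity
  rw [Finset.mem_Icc] at hi
  rw [Finset.mem_range]
  omega

/-- Each `B_k^(i-1)` is positive and fixes constants, hence contracts the sup norm on `[0,1]`; the
binomial coefficients sum to at most `2^h`. The hypothesis bounds the order-one polynomial rather
than its coefficients, so that cancellation and averaging at order one carry over to order `h`. -/
theorem abs_sum_mul_iteratedBasis_le {h k : ℕ} {c : ℕ → ℝ} {M : ℝ}
    (hc : ∀ z ∈ Icc (0 : ℝ) 1, |∑ ν ∈ Finset.range (k + 1), c ν * basis k ν z| ≤ M) :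
    ∀ y ∈ Icc (0 : ℝ) 1, |∑ ν ∈ Finset.range (k + 1), c ν * iteratedBasis h k ν y| ≤ 2 ^ h * M := by
  intro y hy
  have hM : 0 ≤ M := (abs_nonneg _).trans (hc y hy)
  rw [sum_mul_iteratedBasis]
  refine (Finset.abs_sum_le_sum_abs _ _).trans ?_
  refine le_trans (Finset.sum_le_sum (g := fun i => (h.choose i : ℝ) * M) fun i _ => ?_) ?_
  · rw [abs_mul, abs_mul, abs_pow, abs_neg, abs_one, one_pow, mul_one, Nat.abs_cast]
    gcongr
    exact abs_bernsteinEnd_pow_le_const hc _ y hy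
  · rw [← Finset.sum_mul]
    gcongr
    exact sum_choose_Icc_le h

/-- Sampling at the nodes supplies one more factor `B_k`, so the sum is the expansion of `1 - (1 -
B_k)^h` without its zeroth term. -/
theorem sum_node_mul_iteratedBasis {h : ℕ} (k : ℕ) (f : ℝ → ℝ) (y : ℝ) :
    ∑ ν ∈ Finset.range (k + 1), f ((ν : ℝ) / k) * iteratedBasis h k ν y =
      f y - ((1 - bernsteinEnd k) ^ h) f y := by
  rw [sum_mul_iteratedBasis, one_sub_bernsteinEnd_pow_apply, Finset.sum_range_succ']
  simp only [pow_zero, Nat.choose_zero_right, Nat.cast_one, mul_one, one_mul, Module.End.one_apply,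
    sub_add_cancel_right, ← Finset.sum_neg_distrib]
  rw [Finset.sum_bij (i := fun i _ => i - 1)
    (t := Finset.range h)
    (g := fun i => -((-1) ^ (i + 1) * (h.choose (i + 1) : ℝ) * (bernsteinEnd k ^ (i + 1)) f y))]
  · intro i hi
    rw [Finset.mem_Icc] at hi
    rw [Finset.mem_range]
    omega
  · intro i hi j hj hij
    rw [Finset.mem_Icc] at hi hj
    omega
  · intro j hj
    rw [Finset.mem_range] at hj
    exact ⟨j + 1, Finset.mem_Icc.2 ⟨by omega, by omega⟩, by simp⟩
  · intro i hi
    obtain ⟨j, rfl⟩ : ∃ j, i = j + 1 := ⟨i - 1, by rw [Finset.mem_Icc] at hi; omega⟩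
    have : (fun z => ∑ ν ∈ Finset.range (k + 1), f ((ν : ℝ) / k) * basis k ν z)
        = bernsteinEnd k f := rfl
    rw [this, Nat.add_sub_cancel, pow_succ (bernsteinEnd k), Module.End.mul_apply]
    ring

/-! ### The Bernstein operator on polynomials -/

/-- The logarithmic derivative of the weight, cleared of the denominator `y(1 - y)` so that it also
holds at the endpoints. -/
theorem exists_hasDerivAt_basis {k ν : ℕ} (hν : ν ≤ k) (y : ℝ) :
    ∃ d, HasDerivAt (basis k ν) d y ∧ y * (1 - y) * d = ((ν : ℝ) - k * y) * basis k ν y := by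
  have h1 : HasDerivAt (fun z : ℝ => (k.choose ν : ℝ) * z ^ ν) (k.choose ν * (ν * y ^ (ν - 1))) y :=
    (hasDerivAt_pow ν y).const_mul _
  have h2 : HasDerivAt (fun z : ℝ => (1 - z) ^ (k - ν))
      (((k - ν : ℕ) : ℝ) * (1 - y) ^ (k - ν - 1) * (-1)) y :=
    ((hasDerivAt_id y).const_sub 1).pow (k - ν)
  refine ⟨_, h1.mul h2, ?_⟩
  have e1 : (ν : ℝ) * y ^ (ν - 1) * y = ν * y ^ ν := by
    cases ν with
    | zero => simp
    | succ n => rw [Nat.add_sub_cancel]; ring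
  have e2 : ((k - ν : ℕ) : ℝ) * (1 - y) ^ (k - ν - 1) * (1 - y)
      = ((k : ℝ) - ν) * (1 - y) ^ (k - ν) := by
    rw [← Nat.cast_sub hν]
    cases k - ν with
    | zero => simp
    | succ n => rw [Nat.add_sub_cancel]; ring
  unfold basis
  linear_combination ((k.choose ν : ℝ) * (1 - y) * (1 - y) ^ (k - ν)) * e1
    - ((k.choose ν : ℝ) * y * y ^ ν) * e2

/-- Write `ν/k = y + (ν - ky)/k` and recognise the second part as a derivative. This recursion
computes `B_k` on monomials. -/
theorem bernsteinEnd_id_mul {k : ℕ} (hk : 0 < k) {g : ℝ → ℝ} {d y : ℝ}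
    (hd : HasDerivAt (bernsteinEnd k g) d y) :
    bernsteinEnd k (fun x => x * g x) y
      = y * bernsteinEnd k g y + (1 / k : ℝ) * (y * (1 - y) * d) := by
  have hk' : (k : ℝ) ≠ 0 := by exact_mod_cast hk.ne'
  choose! b hb hb' using fun (ν : ℕ) (hν : ν ≤ k) => exists_hasDerivAt_basis hν y
  have h1 : HasDerivAt (bernsteinEnd k g)
      (∑ ν ∈ Finset.range (k + 1), g ((ν : ℝ) / k) * b ν) y := by
    have : bernsteinEnd k g
        = fun z => ∑ ν ∈ Finset.range (k + 1), g ((ν : ℝ) / k) * basis k ν z := rfl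
    rw [this]
    exact HasDerivAt.fun_sum fun ν hν =>
      (hb ν (Nat.lt_succ_iff.1 (Finset.mem_range.1 hν))).const_mul _
  rw [hd.unique h1, bernsteinEnd_apply, bernsteinEnd_apply, Finset.mul_sum, Finset.mul_sum,
    Finset.mul_sum, ← Finset.sum_add_distrib]
  refine Finset.sum_congr rfl fun ν hν => ?_
  have h2 := hb' ν (Nat.lt_succ_iff.1 (Finset.mem_range.1 hν))
  field_simp
  linear_combination (-g ((ν : ℝ) / k)) * h2

/-- The function of `y` obtained from a polynomial in two variables by fixing the first one. -/
noncomputable def evalAt (s : ℝ) (p : Polynomial (Polynomial ℝ)) (y : ℝ) : ℝ :=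
  (p.map (Polynomial.evalRingHom s)).eval y

/-- The inner variable of `q` stands for `1/k`, so that a single `q` serves every `k`. -/
theorem exists_bernsteinEnd_pow_eq (m : ℕ) :
    ∃ q : Polynomial (Polynomial ℝ), ∀ k : ℕ, 0 < k → ∀ y : ℝ,
      bernsteinEnd k (fun x => x ^ m) y = y ^ m + (1 / k : ℝ) * evalAt (1 / k) q y := by
  induction m with
  | zero =>
    refine ⟨0, fun k _ y => ?_⟩
    simp [bernsteinEnd_const, evalAt]
  | succ m ih =>
    obtain ⟨q, hq⟩ := ih
    -- Read off from the recursion with `B_k x^m = y^m + q/k`; the factor `Polynomial.C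
    -- Polynomial.X` is the `1/k` in front of the derivative of `q`.
    refine ⟨Polynomial.X * q + Polynomial.X * (1 - Polynomial.X) *
      ((m : Polynomial (Polynomial ℝ)) * Polynomial.X ^ (m - 1) + Polynomial.C Polynomial.X * q.derivative), fun k hk y => ?_⟩
    have hd : HasDerivAt (bernsteinEnd k fun x => x ^ m)
        (m * y ^ (m - 1) + (1 / k : ℝ) * evalAt (1 / k) q.derivative y) y := by
      have : (bernsteinEnd k fun x => x ^ m)
          = fun y => y ^ m + (1 / k : ℝ) * evalAt (1 / k) q y := funext (hq k hk)
      rw [this]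
      refine (hasDerivAt_pow m y).add (HasDerivAt.const_mul _ ?_)
      unfold evalAt
      rw [← Polynomial.derivative_map]
      exact Polynomial.hasDerivAt _ y
    have h1 := bernsteinEnd_id_mul hk hd
    have h2 : (fun x : ℝ => x ^ (m + 1)) = fun x => x * x ^ m := funext fun x => pow_succ' x m
    rw [h2, h1, hq k hk]
    simp only [evalAt, Polynomial.map_add, Polynomial.map_mul, Polynomial.map_sub,
      Polynomial.map_X, Polynomial.map_one, Polynomial.map_pow, Polynomial.map_natCast,
      Polynomial.map_C, Polynomial.coe_evalRingHom, Polynomial.eval_add, Polynomial.eval_mul,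
      Polynomial.eval_sub, Polynomial.eval_X, Polynomial.eval_one, Polynomial.eval_pow,
      Polynomial.eval_natCast, Polynomial.eval_C]
    ring

theorem evalAt_add (s : ℝ) (p q : Polynomial (Polynomial ℝ)) :
    evalAt s (p + q) = evalAt s p + evalAt s q := by
  ext y
  simp [evalAt]

theorem evalAt_monomial (s : ℝ) (m : ℕ) (a : Polynomial ℝ) :
    evalAt s (Polynomial.monomial m a) = a.eval s • fun y => y ^ m := by
  ext y
  simp [evalAt]

theorem exists_one_sub_bernsteinEnd_evalAt (p : Polynomial (Polynomial ℝ)) :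
    ∃ q : Polynomial (Polynomial ℝ), ∀ k : ℕ, 0 < k →
      (1 - bernsteinEnd k) (evalAt (1 / k) p) = (1 / k : ℝ) • evalAt (1 / k) q := by
  induction p using Polynomial.induction_on' with
  | add p q hp hq =>
    obtain ⟨p', hp'⟩ := hp
    obtain ⟨q', hq'⟩ := hq
    exact ⟨p' + q', fun k hk => by rw [evalAt_add, map_add, hp' k hk, hq' k hk, evalAt_add, smul_add]⟩
  | monomial m a =>
    obtain ⟨q, hq⟩ := exists_bernsteinEnd_pow_eq m
    refine ⟨-(Polynomial.C a * q), fun k hk => ?_⟩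
    ext y
    rw [evalAt_monomial, map_smul]
    simp only [LinearMap.sub_apply, Module.End.one_apply, Pi.smul_apply, Pi.sub_apply, smul_eq_mul,
      hq k hk y, evalAt, Polynomial.map_neg, Polynomial.map_mul, Polynomial.map_C,
      Polynomial.coe_evalRingHom, Polynomial.eval_neg, Polynomial.eval_mul, Polynomial.eval_C]
    ring

/-- After each application of `1 - B_k` the quotient by `1/k` is again polynomial in `y` and `1/k`,
so the gain can be iterated. -/
theorem exists_one_sub_bernsteinEnd_pow_evalAt (h : ℕ) (p : Polynomial (Polynomial ℝ)) :
    ∃ q : Polynomial (Polynomial ℝ), ∀ k : ℕ, 0 < k →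
      ((1 - bernsteinEnd k) ^ h) (evalAt (1 / k) p) = ((1 / k : ℝ) ^ h) • evalAt (1 / k) q := by
  induction h with
  | zero => exact ⟨p, fun k _ => by simp⟩
  | succ h ih =>
    obtain ⟨q, hq⟩ := ih
    obtain ⟨q', hq'⟩ := exists_one_sub_bernsteinEnd_evalAt q
    refine ⟨q', fun k hk => ?_⟩
    rw [pow_succ', Module.End.mul_apply, hq k hk, map_smul, hq' k hk, smul_smul, ← pow_succ]

theorem exists_abs_evalAt_le (q : Polynomial (Polynomial ℝ)) :
    ∃ C : ℝ, ∀ s ∈ Icc (0 : ℝ) 1, ∀ y ∈ Icc (0 : ℝ) 1, |evalAt s q y| ≤ C := by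
  induction q using Polynomial.induction_on' with
  | add p q hp hq =>
    obtain ⟨C, hC⟩ := hp
    obtain ⟨D, hD⟩ := hq
    refine ⟨C + D, fun s hs y hy => ?_⟩
    rw [evalAt_add]
    exact (abs_add_le _ _).trans (add_le_add (hC s hs y hy) (hD s hs y hy))
  | monomial m a =>
    obtain ⟨C, hC⟩ := isCompact_Icc.exists_bound_of_continuousOn
      (f := fun s : ℝ => a.eval s) (s := Icc (0 : ℝ) 1) a.continuous.continuousOn
    refine ⟨C, fun s hs y hy => ?_⟩
    have h1 : |y ^ m| ≤ 1 := by
      rw [abs_of_nonneg (pow_nonneg hy.1 m)]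
      exact pow_le_one₀ hy.1 hy.2
    rw [evalAt_monomial, Pi.smul_apply, smul_eq_mul, abs_mul]
    exact (mul_le_of_le_one_right (abs_nonneg _) h1).trans (hC s hs)

theorem exists_abs_one_sub_bernsteinEnd_pow_monomial_le (h m : ℕ) :
    ∃ C : ℝ, 0 ≤ C ∧ ∀ k : ℕ, 0 < k → ∀ y ∈ Icc (0 : ℝ) 1,
      |((1 - bernsteinEnd k) ^ h) (fun x => x ^ m) y| ≤ C * ((k : ℝ) ^ h)⁻¹ := by
  obtain ⟨q, hq⟩ := exists_one_sub_bernsteinEnd_pow_evalAt h (Polynomial.monomial m 1)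
  obtain ⟨C, hC⟩ := exists_abs_evalAt_le q
  refine ⟨|C|, abs_nonneg C, fun k hk y hy => ?_⟩
  have h1 := hq k hk
  rw [evalAt_monomial, Polynomial.eval_one, one_smul] at h1
  have hk1 : (1 : ℝ) ≤ k := by exact_mod_cast hk
  rw [h1, Pi.smul_apply, smul_eq_mul, abs_mul, one_div, inv_pow, abs_of_nonneg (by positivity),
    mul_comm]
  refine mul_le_mul_of_nonneg_right ?_ (by positivity)
  rw [← one_div]
  exact (hC _ ⟨by positivity, (div_le_one (by linarith)).2 hk1⟩ y hy).trans (le_abs_self C)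

theorem exists_abs_one_sub_bernsteinEnd_pow_sub_pow_le (h m : ℕ) :
    ∃ C : ℝ, 0 ≤ C ∧ ∀ k : ℕ, 0 < k → ∀ y ∈ Icc (0 : ℝ) 1,
      |((1 - bernsteinEnd k) ^ h) (fun x => (x - y) ^ m) y| ≤ C * ((k : ℝ) ^ h)⁻¹ := by
  choose C hC0 hC using exists_abs_one_sub_bernsteinEnd_pow_monomial_le h
  refine ⟨∑ i ∈ Finset.range (m + 1), (m.choose i : ℝ) * C i,
    Finset.sum_nonneg fun i _ => mul_nonneg (by positivity) (hC0 i), fun k hk y hy => ?_⟩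
  have h1 : (fun x : ℝ => (x - y) ^ m)
      = ∑ i ∈ Finset.range (m + 1), ((-y) ^ (m - i) * (m.choose i : ℝ)) • fun x : ℝ => x ^ i := by
    ext x
    rw [sub_eq_add_neg, add_pow, Finset.sum_apply]
    refine Finset.sum_congr rfl fun i _ => ?_
    simp only [Pi.smul_apply, smul_eq_mul]
    ring
  rw [h1, map_sum, Finset.sum_apply, Finset.sum_mul]
  refine (Finset.abs_sum_le_sum_abs _ _).trans (Finset.sum_le_sum fun i _ => ?_)
  rw [map_smul, Pi.smul_apply, smul_eq_mul, abs_mul, abs_mul, Nat.abs_cast, abs_pow, abs_neg,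
    abs_of_nonneg hy.1, mul_assoc (m.choose i : ℝ)]
  have h2 := hC i k hk y hy
  have h3 : y ^ (m - i) ≤ 1 := pow_le_one₀ hy.1 hy.2
  have h4 : 0 ≤ y ^ (m - i) := pow_nonneg hy.1 _
  calc _ ≤ (1 * (m.choose i : ℝ)) * (C i * ((k : ℝ) ^ h)⁻¹) := by gcongr
    _ = _ := by rw [one_mul]

/-! ### Smooth functions of one variable -/

/-- Induction on the order: the derivative of a Taylor remainder is the remainder one order lower
for the shifted sequence `d (· + 1)`, and the mean value inequality integrates the bound. The factor
`1/n!` is given away. -/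
theorem abs_sub_taylor_le {n : ℕ} {T : ℝ} {d : ℕ → ℝ → ℝ}
    (hd : ∀ i < n, ∀ x ∈ Icc (0 : ℝ) 1, HasDerivWithinAt (d i) (d (i + 1) x) (Icc 0 1) x)
    (hT : ∀ x ∈ Icc (0 : ℝ) 1, |d n x| ≤ T) :
    ∀ x ∈ Icc (0 : ℝ) 1, ∀ y ∈ Icc (0 : ℝ) 1,
      |d 0 x - ∑ i ∈ Finset.range n, d i y / i.factorial * (x - y) ^ i| ≤ T * |x - y| ^ n := by
  induction n generalizing d with
  | zero =>
    intro x hx y _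
    simpa using hT x hx
  | succ n ih =>
    intro x hx y hy
    have h1 := ih (d := fun i => d (i + 1)) (fun i hi => hd (i + 1) (by omega)) hT
    set R : ℝ → ℝ := fun x =>
      d 0 x - ∑ i ∈ Finset.range (n + 1), d i y / i.factorial * (x - y) ^ i with hR
    have hsub : uIcc y x ⊆ Icc (0 : ℝ) 1 := ordConnected_Icc.uIcc_subset hy hx
    have hder : ∀ z ∈ uIcc y x, HasDerivWithinAt R
        (d 1 z - ∑ i ∈ Finset.range n, d (i + 1) y / i.factorial * (z - y) ^ i) (uIcc y x) z := by
      intro z hz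
      refine ((hd 0 (by omega) z (hsub hz)).mono hsub).sub ?_
      have h2 : HasDerivAt (fun x => ∑ i ∈ Finset.range (n + 1), d i y / i.factorial * (x - y) ^ i)
          (∑ i ∈ Finset.range (n + 1), d i y / i.factorial * (i * (z - y) ^ (i - 1) * 1)) z :=
        HasDerivAt.fun_sum fun i _ =>
          (((hasDerivAt_id z).sub_const y).pow i).const_mul _
      rw [Finset.sum_range_succ'] at h2
      simp only [Nat.cast_zero, zero_mul, mul_zero, add_zero, Nat.add_sub_cancel, mul_one] at h2
      convert h2.hasDerivWithinAt using 1
      refine Finset.sum_congr rfl fun i _ => ?_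
      rw [Nat.factorial_succ]
      push_cast
      field_simp
    have hbound : ∀ z ∈ uIcc y x,
        ‖d 1 z - ∑ i ∈ Finset.range n, d (i + 1) y / i.factorial * (z - y) ^ i‖
          ≤ T * |x - y| ^ n := by
      intro z hz
      refine (h1 z (hsub hz) y hy).trans ?_
      have hT0 : 0 ≤ T := (abs_nonneg _).trans (hT y hy)
      have := abs_sub_left_of_mem_uIcc hz
      gcongr
    have h3 := (convex_uIcc y x).norm_image_sub_le_of_norm_hasDerivWithin_le hder hbound
      left_mem_uIcc right_mem_uIcc
    have h4 : R y = 0 := by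
      simp only [hR]
      rw [Finset.sum_range_succ']
      simp
    rw [h4, sub_zero, Real.norm_eq_abs, Real.norm_eq_abs, mul_assoc, ← pow_succ] at h3
    exact h3

/-- Even moments around `y` of the Markov chain driven by the Bernstein operator. -/
theorem exists_bernsteinEnd_pow_sub_pow_le (h i : ℕ) :
    ∃ C : ℝ, 0 ≤ C ∧ ∀ k : ℕ, 0 < k → ∀ y : ℝ, ∀ z ∈ Icc (0 : ℝ) 1,
      (bernsteinEnd k ^ i) (fun x => (x - y) ^ (2 * h)) z
        ≤ C * ((z - y) ^ (2 * h) + ((k : ℝ) ^ h)⁻¹) := by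
  induction i with
  | zero =>
    refine ⟨1, zero_le_one, fun k _ y z _ => ?_⟩
    rw [pow_zero, Module.End.one_apply, one_mul]
    exact le_add_of_nonneg_right (by positivity)
  | succ i ih =>
    obtain ⟨C, hC0, hC⟩ := ih
    set M : ℝ := 2 * Real.exp 1 * (2 * h).factorial with hM
    refine ⟨C * (2 ^ (2 * h) * (1 + M) + 1), by positivity, fun k hk y z hz => ?_⟩
    rw [pow_succ', Module.End.mul_apply]
    -- The induction bound is inserted under the outermost `B_k`. What remains is a binomial average
    -- of `(x - y)^(2h)` started from `z`, which splits into a central moment at `z` and `(z -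
    -- y)^(2h)`.
    refine (bernsteinEnd_mono (hC k hk y) z hz).trans ?_
    have hm := sum_pow_sub_mul_basis_le hk h hz
    rw [← hM] at hm
    set κ : ℝ := ((k : ℝ) ^ h)⁻¹ with hκ
    have hκ0 : 0 ≤ κ := by positivity
    have hs0 : 0 ≤ (z - y) ^ (2 * h) := by rw [pow_mul]; positivity
    have h1 : ∀ ν ∈ Finset.range (k + 1), C * (((ν : ℝ) / k - y) ^ (2 * h) + κ) * basis k ν z
        ≤ C * (2 ^ (2 * h) * (((ν : ℝ) / k - z) ^ (2 * h) * basis k ν z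
          + (z - y) ^ (2 * h) * basis k ν z) + κ * basis k ν z) := by
      intro ν _
      have e1 : ((ν : ℝ) / k - y) ^ (2 * h)
          ≤ 2 ^ (2 * h) * (((ν : ℝ) / k - z) ^ (2 * h) + (z - y) ^ (2 * h)) := by
        have e2 := add_pow_le (abs_nonneg ((ν : ℝ) / k - z)) (abs_nonneg (z - y)) (2 * h)
        have e3 : ((ν : ℝ) / k - y) ^ (2 * h) ≤ (|(ν : ℝ) / k - z| + |z - y|) ^ (2 * h) := by
          rw [← (even_two_mul h).pow_abs ((ν : ℝ) / k - y)]
          gcongr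
          have := abs_add_le ((ν : ℝ) / k - z) (z - y)
          rwa [sub_add_sub_cancel] at this
        rw [(even_two_mul h).pow_abs, (even_two_mul h).pow_abs] at e2
        have e4 : (2 : ℝ) ^ (2 * h - 1) ≤ 2 ^ (2 * h) := by gcongr <;> [norm_num; omega]
        have e5 : 0 ≤ ((ν : ℝ) / k - z) ^ (2 * h) := by rw [pow_mul]; positivity
        exact e3.trans (e2.trans (by gcongr))
      have e6 := mul_le_mul_of_nonneg_right (mul_le_mul_of_nonneg_left (add_le_add_left e1 κ) hC0)
        (basis_nonneg hz k ν)
      refine e6.trans (le_of_eq (by ring))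
    refine (Finset.sum_le_sum h1).trans ?_
    rw [← Finset.mul_sum, Finset.sum_add_distrib, ← Finset.mul_sum, Finset.sum_add_distrib,
      ← Finset.mul_sum, ← Finset.mul_sum, sum_basis, mul_one, mul_one, mul_assoc]
    refine mul_le_mul_of_nonneg_left ?_ hC0
    have h2 : (1 : ℝ) ≤ 2 ^ (2 * h) := one_le_pow₀ (by norm_num)
    have hM0 : 0 ≤ M := by positivity
    have h3 : (2 : ℝ) ^ (2 * h) * (∑ ν ∈ Finset.range (k + 1),
        ((ν : ℝ) / k - z) ^ (2 * h) * basis k ν z) ≤ 2 ^ (2 * h) * (M * κ) := by gcongr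
    have h4 : 0 ≤ (2 : ℝ) ^ (2 * h) * κ := by positivity
    have h5 : 0 ≤ (2 : ℝ) ^ (2 * h) * (M * (z - y) ^ (2 * h)) := by positivity
    nlinarith

/-- The iterated Bernstein operator of order `h` approximates `C^{2h}` functions at rate `k^{-h}`. -/
theorem exists_abs_one_sub_bernsteinEnd_pow_le {h : ℕ} (hh : 0 < h) :
    ∃ C : ℝ, 0 ≤ C ∧ ∀ k : ℕ, 0 < k → ∀ (T : ℝ) (d : ℕ → ℝ → ℝ),
      (∀ i < 2 * h, ∀ x ∈ Icc (0 : ℝ) 1, HasDerivWithinAt (d i) (d (i + 1) x) (Icc 0 1) x) →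
      (∀ i, 1 ≤ i → i ≤ 2 * h → ∀ x ∈ Icc (0 : ℝ) 1, |d i x| ≤ T) →
      ∀ y ∈ Icc (0 : ℝ) 1, |((1 - bernsteinEnd k) ^ h) (d 0) y| ≤ C * T * ((k : ℝ) ^ h)⁻¹ := by
  choose A hA0 hA using exists_abs_one_sub_bernsteinEnd_pow_sub_pow_le h
  choose M hM0 hM using exists_bernsteinEnd_pow_sub_pow_le h
  refine ⟨∑ i ∈ Finset.range (2 * h - 1), A (i + 1)
    + ∑ i ∈ Finset.range (h + 1), (h.choose i : ℝ) * M i,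
    add_nonneg (Finset.sum_nonneg fun i _ => hA0 _)
      (Finset.sum_nonneg fun i _ => mul_nonneg (by positivity) (hM0 i)),
    fun k hk T d hd hT y hy => ?_⟩
  set κ : ℝ := ((k : ℝ) ^ h)⁻¹ with hκ
  have hκ0 : 0 ≤ κ := by positivity
  have hT0 : 0 ≤ T := (abs_nonneg _).trans (hT 1 le_rfl (by omega) y hy)
  have htay := abs_sub_taylor_le hd (hT (2 * h) (by omega) le_rfl)
  set R : ℝ → ℝ := fun x =>
    d 0 x - ∑ i ∈ Finset.range (2 * h), d i y / i.factorial * (x - y) ^ i with hR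
  have hRb : ∀ x ∈ Icc (0 : ℝ) 1, |R x| ≤ (T • fun x => (x - y) ^ (2 * h)) x := by
    intro x hx
    refine (htay x hx y hy).trans (le_of_eq ?_)
    rw [(even_two_mul h).pow_abs]
    rfl
  -- The constant Taylor term is separated because `T` does not bound the function itself; `1 - B_k`
  -- annihilates it.
  have hdec : d 0 = R + (∑ i ∈ Finset.range (2 * h - 1),
      (d (i + 1) y / (i + 1).factorial) • fun x : ℝ => (x - y) ^ (i + 1))
      + fun _ => d 0 y := by
    ext x
    have e : 2 * h = (2 * h - 1) + 1 := by omega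
    simp only [hR, Pi.add_apply, Finset.sum_apply, Pi.smul_apply, smul_eq_mul]
    rw [e, Finset.sum_range_succ', Nat.add_sub_cancel]
    simp only [pow_zero, Nat.factorial_zero, Nat.cast_one, div_one, mul_one]
    ring
  have hconst : ((1 - bernsteinEnd k) ^ h) (fun _ => d 0 y) = 0 := by
    obtain ⟨n, rfl⟩ : ∃ n, h = n + 1 := ⟨h - 1, by omega⟩
    rw [pow_succ, Module.End.mul_apply, LinearMap.sub_apply, bernsteinEnd_const,
      Module.End.one_apply, sub_self, map_zero]
  -- No cancellation is needed for the remainder: each iterate has moment `O(k^(-h))` about its own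
  -- starting point `y`.
  have hRes : |((1 - bernsteinEnd k) ^ h) R y|
      ≤ (∑ i ∈ Finset.range (h + 1), (h.choose i : ℝ) * M i) * T * κ := by
    rw [one_sub_bernsteinEnd_pow_apply, Finset.sum_mul, Finset.sum_mul]
    refine (Finset.abs_sum_le_sum_abs _ _).trans (Finset.sum_le_sum fun i _ => ?_)
    rw [abs_mul, abs_mul, abs_pow, abs_neg, abs_one, one_pow, one_mul, Nat.abs_cast, mul_assoc,
      mul_assoc]
    refine mul_le_mul_of_nonneg_left ?_ (by positivity)
    refine (abs_bernsteinEnd_pow_le hRb i y hy).trans ?_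
    rw [map_smul, Pi.smul_apply, smul_eq_mul]
    have := hM i k hk y y hy
    rw [sub_self, zero_pow (by omega), zero_add] at this
    calc _ ≤ T * (M i * κ) := by gcongr
      _ = _ := by ring
  have hPoly : |((1 - bernsteinEnd k) ^ h) (∑ i ∈ Finset.range (2 * h - 1),
      (d (i + 1) y / (i + 1).factorial) • fun x : ℝ => (x - y) ^ (i + 1)) y|
      ≤ (∑ i ∈ Finset.range (2 * h - 1), A (i + 1)) * T * κ := by
    rw [map_sum, Finset.sum_apply, Finset.sum_mul, Finset.sum_mul]
    refine (Finset.abs_sum_le_sum_abs _ _).trans (Finset.sum_le_sum fun i hi => ?_)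
    rw [Finset.mem_range] at hi
    rw [map_smul, Pi.smul_apply, smul_eq_mul, abs_mul, abs_div, Nat.abs_cast]
    have e1 : |d (i + 1) y| / ((i + 1).factorial : ℝ) ≤ T := by
      refine (div_le_self (abs_nonneg _) ?_).trans (hT (i + 1) (by omega) (by omega) y hy)
      exact_mod_cast Nat.succ_le_of_lt (Nat.factorial_pos _)
    calc _ ≤ T * (A (i + 1) * κ) := by
          gcongr
          exact hA (i + 1) k hk y hy
      _ = _ := by ring
  rw [hdec, map_add, map_add, hconst, add_zero, Pi.add_apply]
  refine (abs_add_le _ _).trans ?_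
  linarith

/-! ### Hölder functions of one variable -/

/-- With `w = √k |z|` this is `w^γ ≤ 1 + w²`. It reduces the Hölder modulus to a second moment. -/
theorem rpow_abs_le {k : ℕ} (hk : 0 < k) {γ : ℝ} (h0 : 0 < γ) (h1 : γ ≤ 1) (z : ℝ) :
    |z| ^ γ ≤ (k : ℝ) ^ (-(γ / 2)) * (1 + k * z ^ 2) := by
  have hk' : (0 : ℝ) < k := by exact_mod_cast hk
  have e1 : (k : ℝ) ^ (-(γ / 2)) * (√k * |z|) ^ γ = |z| ^ γ := by
    rw [Real.mul_rpow (Real.sqrt_nonneg _) (abs_nonneg _), ← mul_assoc, Real.sqrt_eq_rpow,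
      ← Real.rpow_mul hk'.le, ← Real.rpow_add hk']
    have : -(γ / 2) + 1 / 2 * γ = 0 := by ring
    rw [this, Real.rpow_zero, one_mul]
  rw [← e1]
  refine mul_le_mul_of_nonneg_left ?_ (by positivity)
  have e2 : (k : ℝ) * z ^ 2 = (√k * |z|) ^ 2 := by
    rw [mul_pow, Real.sq_sqrt hk'.le, sq_abs]
  rw [e2]
  set w : ℝ := √k * |z|
  have hw : 0 ≤ w := by positivity
  rcases le_total w 1 with h | h
  · exact (Real.rpow_le_one hw h h0.le).trans (by nlinarith)
  · have : w ^ γ ≤ w ^ (1 : ℝ) := Real.rpow_le_rpow_of_exponent_le h h1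
    rw [Real.rpow_one] at this
    nlinarith

theorem abs_bernsteinEnd_sub_le_of_holder {k : ℕ} (hk : 0 < k) {γ L : ℝ} (h0 : 0 < γ)
    (h1 : γ ≤ 1) (hL : 0 ≤ L) {f : ℝ → ℝ}
    (hf : ∀ x ∈ Icc (0 : ℝ) 1, ∀ y ∈ Icc (0 : ℝ) 1, |f x - f y| ≤ L * |x - y| ^ γ) :
    ∀ y ∈ Icc (0 : ℝ) 1, |bernsteinEnd k f y - f y|
      ≤ L * (1 + 4 * Real.exp 1) * (k : ℝ) ^ (-(γ / 2)) := by
  intro y hy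
  have hk' : (0 : ℝ) < k := by exact_mod_cast hk
  have e1 : bernsteinEnd k f y - f y
      = ∑ ν ∈ Finset.range (k + 1), (f ((ν : ℝ) / k) - f y) * basis k ν y := by
    simp only [sub_mul, Finset.sum_sub_distrib, ← Finset.mul_sum, sum_basis, mul_one]
    rfl
  rw [e1]
  refine (Finset.abs_sum_le_sum_abs _ _).trans ?_
  have e2 : ∀ ν ∈ Finset.range (k + 1), |(f ((ν : ℝ) / k) - f y) * basis k ν y|
      ≤ L * (k : ℝ) ^ (-(γ / 2)) * (basis k ν y + k * (((ν : ℝ) / k - y) ^ (2 * 1) * basis k ν y)) := by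
    intro ν hν
    rw [abs_mul, abs_of_nonneg (basis_nonneg hy k ν)]
    have := (hf _ (node_mem_Icc hν) y hy).trans
      (mul_le_mul_of_nonneg_left (rpow_abs_le hk h0 h1 ((ν : ℝ) / k - y)) hL)
    refine (mul_le_mul_of_nonneg_right this (basis_nonneg hy k ν)).trans (le_of_eq (by ring))
  refine (Finset.sum_le_sum e2).trans ?_
  have e3 := sum_pow_sub_mul_basis_le hk 1 hy
  rw [← Finset.mul_sum, Finset.sum_add_distrib, sum_basis, ← Finset.mul_sum]
  have e4 : (k : ℝ) * ∑ ν ∈ Finset.range (k + 1), ((ν : ℝ) / k - y) ^ (2 * 1) * basis k ν y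
      ≤ 4 * Real.exp 1 := by
    refine (mul_le_mul_of_nonneg_left e3 hk'.le).trans (le_of_eq ?_)
    norm_num [Nat.factorial]
    field_simp
    norm_num
  have e5 : 0 ≤ L * (k : ℝ) ^ (-(γ / 2)) := by positivity
  nlinarith

/-- One factor `1 - B_k` produces `η`; the other `h - 1` are expanded, and each power of `B_k` is a
contraction. -/
theorem abs_one_sub_bernsteinEnd_pow_le_of_abs_sub_le {k h : ℕ} (hh : 0 < h) {f : ℝ → ℝ} {η : ℝ}
    (hf : ∀ y ∈ Icc (0 : ℝ) 1, |bernsteinEnd k f y - f y| ≤ η) :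
    ∀ y ∈ Icc (0 : ℝ) 1, |((1 - bernsteinEnd k) ^ h) f y| ≤ 2 ^ (h - 1) * η := by
  intro y hy
  obtain ⟨n, rfl⟩ : ∃ n, h = n + 1 := ⟨h - 1, by omega⟩
  rw [pow_succ, Module.End.mul_apply, one_sub_bernsteinEnd_pow_apply, Nat.add_sub_cancel]
  have e1 : ∑ i ∈ Finset.range (n + 1), (n.choose i : ℝ) = 2 ^ n := by
    exact_mod_cast Nat.sum_range_choose n
  rw [← e1, Finset.sum_mul]
  refine (Finset.abs_sum_le_sum_abs _ _).trans (Finset.sum_le_sum fun i _ => ?_)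
  rw [abs_mul, abs_mul, abs_pow, abs_neg, abs_one, one_pow, one_mul, Nat.abs_cast]
  refine mul_le_mul_of_nonneg_left (abs_bernsteinEnd_pow_le_const (fun z hz => ?_) i y hy)
    (by positivity)
  have := hf z hz
  rwa [abs_sub_comm] at this

/-! ### Tensor products -/

theorem cons_mem_cube {l : ℕ} {t : ℝ} {x : Fin l → ℝ} (ht : t ∈ Icc (0 : ℝ) 1) (hx : x ∈ cube l) :
    (Fin.cons t x : Fin (l + 1) → ℝ) ∈ cube (l + 1) := by
  constructor <;> intro i <;> refine Fin.cases ?_ (fun j => ?_) i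
  · simpa using ht.1
  · simpa using hx.1 j
  · simpa using ht.2
  · simpa using hx.2 j

theorem tail_mem_cube {l : ℕ} {y : Fin (l + 1) → ℝ} (hy : y ∈ cube (l + 1)) :
    Fin.tail y ∈ cube l := ⟨fun i => hy.1 i.succ, fun i => hy.2 i.succ⟩

theorem apply_mem_Icc {l : ℕ} {y : Fin l → ℝ} (hy : y ∈ cube l) (i : Fin l) :
    y i ∈ Icc (0 : ℝ) 1 := ⟨hy.1 i, hy.2 i⟩

theorem update_mem_cube {l : ℕ} {x : Fin l → ℝ} (hx : x ∈ cube l) (i : Fin l) {t : ℝ}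
    (ht : t ∈ Icc (0 : ℝ) 1) : Function.update x i t ∈ cube l := by
  constructor <;> intro j <;> rcases eq_or_ne j i with rfl | hj
  · simpa using ht.1
  · simpa [hj] using hx.1 j
  · simpa using ht.2
  · simpa [hj] using hx.2 j

theorem fin_node_mem_Icc {k : ℕ} (v : Fin (k + 1)) : ((v : ℕ) : ℝ) / k ∈ Icc (0 : ℝ) 1 :=
  node_mem_Icc (Finset.mem_range.2 v.2)

theorem latticePoint_mem_cube {l k : ℕ} (ν : Lattice l k) : latticePoint ν ∈ cube l :=
  ⟨fun i => (fin_node_mem_Icc (ν i)).1, fun i => (fin_node_mem_Icc (ν i)).2⟩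

theorem latticePoint_cons {l k : ℕ} (v : Fin (k + 1)) (ν : Lattice l k) :
    latticePoint (Fin.cons v ν : Lattice (l + 1) k)
      = Fin.cons (((v : ℕ) : ℝ) / k) (latticePoint ν) := by
  ext i
  refine Fin.cases ?_ (fun j => ?_) i <;> simp [latticePoint]

theorem iteratedBasis_one (k ν : ℕ) : iteratedBasis 1 k ν = basis k ν := by
  ext y
  simp [iteratedBasis]

theorem evaluate_succ {l k : ℕ} (h : ℕ) (a : Lattice (l + 1) k → ℝ) (y : Fin (l + 1) → ℝ) :
    evaluate h a y = ∑ v : Fin (k + 1),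
      evaluate h (fun ν : Lattice l k => a (Fin.cons v ν)) (Fin.tail y)
        * iteratedBasis h k v (y 0) := by
  unfold evaluate
  rw [← (Fin.consEquiv fun _ : Fin (l + 1) => Fin (k + 1)).sum_comp, Fintype.sum_prod_type]
  refine Finset.sum_congr rfl fun v _ => ?_
  rw [Finset.sum_mul]
  refine Finset.sum_congr rfl fun ν _ => ?_
  rw [Fin.prod_univ_succ]
  have : (Fin.consEquiv fun _ : Fin (l + 1) => Fin (k + 1)) (v, ν) = Fin.cons v ν := rfl
  simp only [this, Fin.cons_zero, Fin.cons_succ, Fin.tail]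
  ring

theorem evaluate_sub {l k : ℕ} (h : ℕ) (a b : Lattice l k → ℝ) (y : Fin l → ℝ) :
    evaluate h (fun ν => a ν - b ν) y = evaluate h a y - evaluate h b y := by
  simp only [evaluate, sub_mul, Finset.sum_sub_distrib]

theorem evaluate_sum_mul {l k : ℕ} {ι : Type*} (s : Finset ι) (h : ℕ) (a : ι → Lattice l k → ℝ)
    (c : ι → ℝ) (y : Fin l → ℝ) :
    evaluate h (fun ν => ∑ i ∈ s, a i ν * c i) y = ∑ i ∈ s, evaluate h (a i) y * c i := by
  simp only [evaluate, Finset.sum_mul]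
  rw [Finset.sum_comm]
  exact Finset.sum_congr rfl fun _ _ => Finset.sum_congr rfl fun _ _ => by ring

theorem abs_sum_fin_mul_iteratedBasis_le {h k : ℕ} {c : Fin (k + 1) → ℝ} {M : ℝ}
    (hc : ∀ z ∈ Icc (0 : ℝ) 1, |∑ v, c v * iteratedBasis 1 k v z| ≤ M) {y : ℝ}
    (hy : y ∈ Icc (0 : ℝ) 1) : |∑ v, c v * iteratedBasis h k v y| ≤ 2 ^ h * M := by
  set c' : ℕ → ℝ := fun ν => if hν : ν < k + 1 then c ⟨ν, hν⟩ else 0 with hc'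
  have key : ∀ (m : ℕ) (z : ℝ), ∑ v, c v * iteratedBasis m k v z
      = ∑ ν ∈ Finset.range (k + 1), c' ν * iteratedBasis m k ν z := by
    intro m z
    rw [← Fin.sum_univ_eq_sum_range (fun ν => c' ν * iteratedBasis m k ν z)]
    exact Finset.sum_congr rfl fun v _ => by simp only [hc', dif_pos v.2, Fin.eta]
  rw [key]
  refine abs_sum_mul_iteratedBasis_le (fun z hz => ?_) y hy
  have := hc z hz
  rw [key] at this
  simpa only [iteratedBasis_one] using this

theorem abs_sum_fin_mul_iteratedBasis_le_of_abs_le {h k : ℕ} {c : Fin (k + 1) → ℝ} {M : ℝ}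
    (hc : ∀ v, |c v| ≤ M) {y : ℝ} (hy : y ∈ Icc (0 : ℝ) 1) :
    |∑ v, c v * iteratedBasis h k v y| ≤ 2 ^ h * M := by
  refine abs_sum_fin_mul_iteratedBasis_le (fun z hz => ?_) hy
  refine (Finset.abs_sum_le_sum_abs _ _).trans ?_
  have h1 : ∑ v : Fin (k + 1), M * iteratedBasis 1 k v z = M := by
    rw [Fin.sum_univ_eq_sum_range (fun ν => M * iteratedBasis 1 k ν z), ← Finset.mul_sum]
    simp only [iteratedBasis_one, sum_basis, mul_one]
  rw [← h1]
  refine Finset.sum_le_sum fun v _ => ?_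
  rw [abs_mul, iteratedBasis_one, abs_of_nonneg (basis_nonneg hz k v)]
  exact mul_le_mul_of_nonneg_right (hc v) (basis_nonneg hz k v)

/-- The iterated evaluation is controlled by the evaluation of order one. -/
theorem abs_evaluate_le {l k : ℕ} (h : ℕ) {a : Lattice l k → ℝ} {M : ℝ}
    (ha : ∀ z ∈ cube l, |evaluate 1 a z| ≤ M) :
    ∀ y ∈ cube l, |evaluate h a y| ≤ (2 ^ h) ^ l * M := by
  induction l with
  | zero =>
    intro y hy
    simpa [evaluate] using ha y hy
  | succ l ih =>
    intro y hy
    rw [evaluate_succ, pow_succ', mul_assoc]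
    refine abs_sum_fin_mul_iteratedBasis_le (fun z hz => ?_) (apply_mem_Icc hy 0)
    -- With the first coordinate at order one, its weights are absorbed into the coefficients, so
    -- the induction hypothesis raises the order in the other coordinates.
    rw [← evaluate_sum_mul Finset.univ h (fun v (ν : Lattice l k) => a (Fin.cons v ν))
      (fun v => iteratedBasis 1 k v z)]
    refine ih (fun z' hz' => ?_) _ (tail_mem_cube hy)
    have h1 := ha _ (cons_mem_cube hz hz')
    rw [evaluate_succ] at h1
    simpa only [evaluate_sum_mul, Fin.tail_cons, Fin.cons_zero] using h1

/-- Approximation errors along the coordinate directions add up. -/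
theorem abs_evaluate_sub_le {l k h : ℕ} {f : (Fin l → ℝ) → ℝ} {η : ℝ} (hη : 0 ≤ η)
    (hf : ∀ i, ∀ x ∈ cube l, |∑ v : Fin (k + 1),
      f (Function.update x i (((v : ℕ) : ℝ) / k)) * iteratedBasis h k v (x i) - f x| ≤ η) :
    ∀ y ∈ cube l, |evaluate h (fun ν : Lattice l k => f (latticePoint ν)) y - f y|
      ≤ l * (2 ^ h) ^ l * η := by
  induction l with
  | zero =>
    intro y hy
    have : ∀ z : Fin 0 → ℝ, f z = f y := fun z => by rw [Subsingleton.elim z y]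
    simp [evaluate, this]
  | succ l ih =>
    intro y hy
    have h1 : ∀ v : Fin (k + 1),
        |evaluate h (fun ν : Lattice l k => f (latticePoint (Fin.cons v ν : Lattice (l + 1) k)))
          (Fin.tail y) - f (Fin.cons (((v : ℕ) : ℝ) / k) (Fin.tail y))| ≤ l * (2 ^ h) ^ l * η := by
      intro v
      simp only [latticePoint_cons]
      refine ih (f := fun x => f (Fin.cons (((v : ℕ) : ℝ) / k) x)) (fun i x hx => ?_) _
        (tail_mem_cube hy)
      have := hf i.succ _ (cons_mem_cube (fin_node_mem_Icc v) hx)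
      simpa only [← Fin.cons_update, Fin.cons_succ] using this
    -- The errors of the remaining coordinates, one for each node of the first, are combined by
    -- weights that amplify by at most `2^h`; the first coordinate then adds its own `η`.
    have h2 := abs_sum_fin_mul_iteratedBasis_le_of_abs_le (h := h) h1 (apply_mem_Icc hy 0)
    have h3 := hf 0 y hy
    have h4 : ∀ t : ℝ, Function.update y 0 t = Fin.cons t (Fin.tail y) := by
      intro t
      conv_lhs => rw [← Fin.cons_self_tail y, Fin.update_cons_zero]
    simp only [h4] at h3
    simp only [sub_mul, Finset.sum_sub_distrib] at h2
    rw [evaluate_succ]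
    have h5 : (1 : ℝ) ≤ (2 ^ h) ^ (l + 1) := one_le_pow₀ (one_le_pow₀ (by norm_num))
    have h6 := (abs_add_le _ _).trans (add_le_add h2 h3)
    rw [sub_add_sub_cancel] at h6
    refine h6.trans ?_
    push_cast
    have h7 : η ≤ (2 ^ h) ^ (l + 1) * η := le_mul_of_one_le_left hη h5
    calc _ ≤ (2 : ℝ) ^ h * (l * (2 ^ h) ^ l * η) + (2 ^ h) ^ (l + 1) * η := by gcongr
      _ = _ := by ring

/-! ### Approximation on the cube -/

theorem sum_update_mul_iteratedBasis {l k h : ℕ} (f : (Fin l → ℝ) → ℝ) (i : Fin l)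
    (x : Fin l → ℝ) :
    ∑ v : Fin (k + 1), f (Function.update x i (((v : ℕ) : ℝ) / k)) * iteratedBasis h k v (x i)
      - f x = -((1 - bernsteinEnd k) ^ h) (fun t => f (Function.update x i t)) (x i) := by
  rw [Fin.sum_univ_eq_sum_range
    (fun ν => f (Function.update x i ((ν : ℝ) / k)) * iteratedBasis h k ν (x i)),
    sum_node_mul_iteratedBasis k (fun t => f (Function.update x i t)), Function.update_eq_self]
  ring

theorem uniqueDiffOn_cube (l : ℕ) : UniqueDiffOn ℝ (cube l) := by
  have : cube l = univ.pi fun _ => Icc (0 : ℝ) 1 := (pi_univ_Icc _ _).symm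
  rw [this]
  exact UniqueDiffOn.univ_pi fun _ => uniqueDiffOn_Icc zero_lt_one

/-- Supplies the derivative chain along a coordinate line that the one-variable estimate requires.
-/
theorem hasDerivWithinAt_iteratedFDerivWithin_update {l n j : ℕ} {f : (Fin l → ℝ) → ℝ}
    (hf : ContDiffOn ℝ n f (cube l)) (hj : j < n) {x : Fin l → ℝ} (hx : x ∈ cube l) (i : Fin l)
    {t : ℝ} (ht : t ∈ Icc (0 : ℝ) 1) :
    HasDerivWithinAt (fun t => iteratedFDerivWithin ℝ j f (cube l) (Function.update x i t)
        fun _ => Pi.single i 1)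
      (iteratedFDerivWithin ℝ (j + 1) f (cube l) (Function.update x i t) fun _ => Pi.single i 1)
      (Icc 0 1) t := by
  have h1 := ((hf.differentiableOn_iteratedFDerivWithin (by exact_mod_cast hj)
    (uniqueDiffOn_cube l)) _ (update_mem_cube hx i ht)).hasFDerivWithinAt
  have h2 := h1.comp_hasDerivWithinAt t (hasDerivAt_update x i t).hasDerivWithinAt
    (fun s hs => update_mem_cube hx i hs)
  have h3 := (ContinuousMultilinearMap.apply ℝ (fun _ : Fin j => Fin l → ℝ) ℝ
    (fun _ => Pi.single i 1)).hasFDerivAt.comp_hasDerivWithinAt t h2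
  exact h3

/-- The exponent is kept as `2h / 2` so that smooth and Hölder functions share the form `k^(-p/2)`.
-/
theorem exists_abs_evaluate_sub_le_of_isSmooth (l : ℕ) {h : ℕ} (hh : 0 < h) {T : ℝ} (hT : 0 < T) :
    ∃ C : ℝ, 0 ≤ C ∧ ∀ k : ℕ, 0 < k → ∀ f : (Fin l → ℝ) → ℝ, IsSmooth (2 * h) T f →
      ∀ y ∈ cube l, |evaluate h (fun ν : Lattice l k => f (latticePoint ν)) y - f y|
        ≤ C * (k : ℝ) ^ (-((2 * h : ℝ) / 2)) := by
  obtain ⟨C, hC0, hC⟩ := exists_abs_one_sub_bernsteinEnd_pow_le hh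
  refine ⟨l * (2 ^ h) ^ l * (C * T), by positivity, fun k hk f hf => ?_⟩
  have e : (k : ℝ) ^ (-((2 * h : ℝ) / 2)) = ((k : ℝ) ^ h)⁻¹ := by
    rw [mul_div_cancel_left₀ _ two_ne_zero, Real.rpow_neg (by positivity), Real.rpow_natCast]
  rw [e, mul_assoc]
  refine abs_evaluate_sub_le (by positivity) fun i x hx => ?_
  rw [sum_update_mul_iteratedBasis, abs_neg]
  have := hC k hk T (fun j t => iteratedFDerivWithin ℝ j f (cube l) (Function.update x i t)
      fun _ => Pi.single i 1)
    (fun j hj t ht => hasDerivWithinAt_iteratedFDerivWithin_update hf.1 hj hx i ht)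
    (fun j h1 h2 t ht => hf.2 j h1 h2 (fun _ => i) _ (update_mem_cube hx i ht))
    (x i) (apply_mem_Icc hx i)
  simpa only [iteratedFDerivWithin_zero_apply] using this

theorem exists_abs_evaluate_sub_le_of_isHolder (l : ℕ) {h : ℕ} (hh : 0 < h) {γ L : ℝ} (h0 : 0 < γ)
    (h1 : γ ≤ 1) (hL : 0 < L) :
    ∃ C : ℝ, 0 ≤ C ∧ ∀ k : ℕ, 0 < k → ∀ f : (Fin l → ℝ) → ℝ, IsHolder γ L f →
      ∀ y ∈ cube l, |evaluate h (fun ν : Lattice l k => f (latticePoint ν)) y - f y|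
        ≤ C * (k : ℝ) ^ (-(γ / 2)) := by
  refine ⟨l * (2 ^ h) ^ l * (2 ^ (h - 1) * (L * (1 + 4 * Real.exp 1))), by positivity,
    fun k hk f hf => ?_⟩
  rw [mul_assoc]
  refine abs_evaluate_sub_le (by positivity) fun i x hx => ?_
  rw [sum_update_mul_iteratedBasis, abs_neg, mul_assoc]
  refine abs_one_sub_bernsteinEnd_pow_le_of_abs_sub_le hh
    (abs_bernsteinEnd_sub_le_of_holder hk h0 h1 hL.le fun s hs t ht => ?_) _ (apply_mem_Icc hx i)
  refine (hf _ (update_mem_cube hx i hs) _ (update_mem_cube hx i ht)).trans ?_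
  have : ‖Function.update x i s - Function.update x i t‖ ≤ |s - t| := by
    rw [pi_norm_le_iff_of_nonneg (abs_nonneg _)]
    intro j
    rcases eq_or_ne j i with rfl | hj
    · simp
    · simp [hj]
  gcongr

/-! ### Local size and unimodality of the Bernstein weights -/

theorem basis_eq_zero {k ν : ℕ} (h : k < ν) (y : ℝ) : basis k ν y = 0 := by
  simp [basis, Nat.choose_eq_zero_of_lt h]

theorem basis_succ (k ν : ℕ) (hν : ν ≤ k) (y : ℝ) :
    ((ν : ℝ) + 1) * (1 - y) * basis k (ν + 1) y = ((k : ℝ) - ν) * y * basis k ν y := by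
  rcases hν.eq_or_lt with rfl | h
  · rw [basis_eq_zero (Nat.lt_succ_self ν)]
    ring
  · have h1 : (k.choose (ν + 1) : ℝ) * ((ν : ℝ) + 1) = k.choose ν * ((k : ℝ) - ν) := by
      rw [← Nat.cast_sub hν]
      exact_mod_cast Nat.choose_succ_right_eq k ν
    have h2 : (1 - y) ^ (k - ν) = (1 - y) ^ (k - (ν + 1)) * (1 - y) := by
      rw [← pow_succ]
      congr 1
      omega
    unfold basis
    rw [h2]
    linear_combination (y ^ (ν + 1) * (1 - y) * (1 - y) ^ (k - (ν + 1))) * h1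

theorem basis_flip {k ν : ℕ} (hν : ν ≤ k) (y : ℝ) : basis k (k - ν) (1 - y) = basis k ν y := by
  unfold basis
  rw [Nat.choose_symm hν, Nat.sub_sub_self hν, sub_sub_cancel]
  ring

theorem basis_le_basis_succ {k ν : ℕ} {y : ℝ} (hy : y ∈ Icc (0 : ℝ) 1) (hν : ν < k)
    (h : (ν : ℝ) + 1 ≤ (k + 1) * y) : basis k ν y ≤ basis k (ν + 1) y := by
  have h1 := basis_succ k ν hν.le y
  have hν' : (ν : ℝ) + 1 ≤ k := by exact_mod_cast hν
  have h2 : 0 < ((k : ℝ) - ν) * y := by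
    refine mul_pos (by linarith) ?_
    rcases hy.1.eq_or_lt with h0 | h0
    · rw [← h0, mul_zero] at h
      have : (0 : ℝ) ≤ ν := by positivity
      linarith
    · exact h0
  refine le_of_mul_le_mul_left ?_ h2
  rw [← h1]
  exact mul_le_mul_of_nonneg_right (by linarith) (basis_nonneg hy k _)

theorem basis_succ_le_basis {k ν : ℕ} {y : ℝ} (hy : y ∈ Icc (0 : ℝ) 1) (hν : ν < k)
    (h : (k + 1) * y ≤ (ν : ℝ) + 1) : basis k (ν + 1) y ≤ basis k ν y := by
  have h1 := basis_succ k ν hν.le y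
  have hν' : (ν : ℝ) + 1 ≤ k := by exact_mod_cast hν
  have h2 : 0 < ((ν : ℝ) + 1) * (1 - y) := by
    refine mul_pos (by positivity) ?_
    by_contra hc
    have : y = 1 := le_antisymm hy.2 (by linarith)
    rw [this] at h
    linarith
  refine le_of_mul_le_mul_left ?_ h2
  rw [h1]
  exact mul_le_mul_of_nonneg_right (by linarith) (basis_nonneg hy k _)

/-- Since the numbers `2i + 1` add up to squares, `i` steps lose at most a factor `1 - i²/ν`. Hence
the first `⌊√ν⌋/2 + 1` terms are at least `3/4 · c 0`, and a total of at most 1 forces `c 0` to be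
of order `1/√ν`. -/
theorem mul_sqrt_le_of_slowly_decreasing {ν : ℕ} (hν : 0 < ν) {c : ℕ → ℝ} (h0 : ∀ i, 0 ≤ c i)
    (hstep : ∀ i, (i + 1) ^ 2 ≤ ν → ((ν : ℝ) - (2 * i + 1)) * c i ≤ ν * c (i + 1))
    (hsum : ∑ i ∈ Finset.range (Nat.sqrt ν / 2 + 1), c i ≤ 1) :
    (2 * (Nat.sqrt ν : ℝ) + 1) * c 0 ≤ 6 := by
  have hν' : (0 : ℝ) < ν := by exact_mod_cast hν
  have h1 : ∀ i : ℕ, i ^ 2 ≤ ν → ((ν : ℝ) - i ^ 2) * c 0 ≤ ν * c i := by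
    intro i
    induction i with
    | zero => intro _; simp
    | succ i ih =>
      intro hi
      have h2 := ih (le_trans (Nat.pow_le_pow_left (Nat.le_succ i) 2) hi)
      have h3 := hstep i hi
      have h4 : ((i : ℝ) + 1) ^ 2 ≤ ν := by exact_mod_cast hi
      have h5 : 0 ≤ (ν : ℝ) - (2 * i + 1) := by nlinarith
      have h6 := mul_le_mul_of_nonneg_left h2 h5
      have h7 := mul_le_mul_of_nonneg_left h3 hν'.le
      refine le_of_mul_le_mul_left ?_ hν'
      push_cast
      have h8 : 0 ≤ (2 * (i : ℝ) + 1) * i ^ 2 * c 0 := mul_nonneg (by positivity) (h0 0)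
      nlinarith
  set s := Nat.sqrt ν with hs
  have h2 : ∀ i ∈ Finset.range (s / 2 + 1), 3 / 4 * c 0 ≤ c i := by
    intro i hi
    rw [Finset.mem_range] at hi
    have h3 : (2 * i) ^ 2 ≤ ν := by
      calc (2 * i) ^ 2 ≤ s ^ 2 := Nat.pow_le_pow_left (by omega) 2
        _ ≤ ν := Nat.sqrt_le' ν
    have h4 := h1 i (le_trans (Nat.pow_le_pow_left (by omega) 2) h3)
    have h5 : (2 * (i : ℝ)) ^ 2 ≤ ν := by exact_mod_cast h3
    refine le_of_mul_le_mul_left ?_ hν'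
    nlinarith [h0 0]
  have h3 := Finset.sum_le_sum h2
  rw [Finset.sum_const, Finset.card_range, nsmul_eq_mul] at h3
  have h4 : (s : ℝ) + 1 ≤ 2 * ((s / 2 + 1 : ℕ) : ℝ) := by
    have : s + 1 ≤ 2 * (s / 2 + 1) := by omega
    exact_mod_cast this
  nlinarith [h0 0]

theorem sum_basis_comp_le {k : ℕ} {y : ℝ} (hy : y ∈ Icc (0 : ℝ) 1) {N : ℕ} {f : ℕ → ℕ}
    (hinj : Set.InjOn f (Finset.range N)) (hf : ∀ i < N, f i ≤ k) :
    ∑ i ∈ Finset.range N, basis k (f i) y ≤ 1 := by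
  rw [← sum_basis k y, ← Finset.sum_image (f := fun ν => basis k ν y) hinj]
  refine Finset.sum_le_sum_of_subset_of_nonneg (fun ν hν => ?_) fun ν _ _ => basis_nonneg hy k ν
  obtain ⟨i, hi, rfl⟩ := Finset.mem_image.1 hν
  exact Finset.mem_range.2 (Nat.lt_succ_of_le (hf i (Finset.mem_range.1 hi)))

theorem basis_le_one {k ν : ℕ} {y : ℝ} (hy : y ∈ Icc (0 : ℝ) 1) : basis k ν y ≤ 1 := by
  rcases lt_or_ge k ν with h | h
  · rw [basis_eq_zero h]
    exact zero_le_one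
  · simpa using sum_basis_comp_le hy (N := 1) (f := fun _ => ν)
      (fun i hi j hj _ => by simp at hi hj; omega) fun _ _ => h

theorem sqrt_mul_basis_le {k ν : ℕ} (hν : 2 * ν ≤ k) {y : ℝ} (hy : y ∈ Icc (0 : ℝ) 1) :
    (2 * (Nat.sqrt ν : ℝ) + 1) * basis k ν y ≤ 6 := by
  rcases Nat.eq_zero_or_pos ν with rfl | hpos
  · have := basis_le_one (k := k) (ν := 0) hy
    norm_num
    linarith
  have hs : Nat.sqrt ν ≤ ν := Nat.sqrt_le_self ν
  have hν' : (0 : ℝ) < ν := by exact_mod_cast hpos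
  have hn : (ν : ℝ) ≤ (k : ℝ) - ν := by
    have : (2 : ℝ) * ν ≤ k := by exact_mod_cast hν
    linarith
  have hk' : (0 : ℝ) < k := by linarith
  -- Walk from `ν` in the direction of the mean `ky`, upwards or downwards: there consecutive ratios
  -- cannot be small. The condition `2ν ≤ k`, as `ν ≤ k - ν`, puts the loss in terms of `ν` alone.
  rcases le_total (ν : ℝ) (k * y) with hc | hc
  · refine mul_sqrt_le_of_slowly_decreasing (c := fun i => basis k (ν + i) y) hpos
      (fun i => basis_nonneg hy k _) (fun i hi => ?_) ?_
    · have hi' : i + 1 ≤ ν := le_trans (Nat.le_self_pow two_ne_zero _) hi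
      have hiν : (i : ℝ) + 1 ≤ ν := by exact_mod_cast hi'
      have h1 := basis_succ k (ν + i) (by omega) y
      push_cast at h1
      have b0 := basis_nonneg hy k (ν + i)
      have b1 := basis_nonneg hy k (ν + i + 1)
      rw [← add_assoc]
      set n : ℝ := (k : ℝ) - ν with hn'
      have hn0 : 0 < n := hν'.trans_le hn
      have e1 : (1 - y) * k ≤ n := by rw [hn']; linarith
      have h2 : (n - i) * ν * basis k (ν + i) y ≤ (ν + i + 1) * n * basis k (ν + i + 1) y := by
        calc (n - i) * ν * basis k (ν + i) y ≤ (n - i) * (k * y) * basis k (ν + i) y := by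
              have : 0 ≤ n - i := by linarith
              gcongr
          _ = (ν + i + 1) * ((1 - y) * k) * basis k (ν + i + 1) y := by
              rw [hn']
              linear_combination (-k : ℝ) * h1
          _ ≤ _ := by gcongr
      refine le_of_mul_le_mul_left (a := (ν + i + 1) * n) ?_ (by positivity)
      have h3 : ((ν : ℝ) + i + 1) * n * (ν - (2 * i + 1)) ≤ ν * ((n - i) * ν) := by
        nlinarith [mul_le_mul_of_nonneg_right hn (by positivity : (0 : ℝ) ≤ i * ν),
          mul_nonneg (by positivity : (0 : ℝ) ≤ (2 * i + 1) * (i + 1)) (hν'.le.trans hn)]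
      have h4 := mul_le_mul_of_nonneg_right h3 b0
      have h5 := mul_le_mul_of_nonneg_left h2 hν'.le
      linarith
    · exact sum_basis_comp_le hy (fun i _ j _ hij => by simpa using hij) fun i hi => by omega
  · refine mul_sqrt_le_of_slowly_decreasing (c := fun i => basis k (ν - i) y) hpos
      (fun i => basis_nonneg hy k _) (fun i hi => ?_) ?_
    · have hi' : i + 1 ≤ ν := le_trans (Nat.le_self_pow two_ne_zero _) hi
      have hiν : (i : ℝ) + 1 ≤ ν := by exact_mod_cast hi'
      have h1 := basis_succ k (ν - (i + 1)) (by omega) y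
      have e2 : ν - (i + 1) + 1 = ν - i := by omega
      rw [e2, Nat.cast_sub hi'] at h1
      push_cast at h1
      have b0 := basis_nonneg hy k (ν - i)
      have b1 := basis_nonneg hy k (ν - (i + 1))
      set n : ℝ := (k : ℝ) - ν with hn'
      have hn0 : 0 < n := hν'.trans_le hn
      have e1 : n ≤ (1 - y) * k := by rw [hn']; linarith
      have h2 : (ν - i) * n * basis k (ν - i) y ≤ (n + i + 1) * ν * basis k (ν - (i + 1)) y := by
        calc (ν - i) * n * basis k (ν - i) y ≤ (ν - i) * ((1 - y) * k) * basis k (ν - i) y := by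
              have : 0 ≤ (ν : ℝ) - i := by linarith
              gcongr
          _ = (n + i + 1) * (k * y) * basis k (ν - (i + 1)) y := by
              rw [hn']
              linear_combination (k : ℝ) * h1
          _ ≤ _ := by
              have : 0 ≤ n + i + 1 := by positivity
              gcongr
      refine le_of_mul_le_mul_left (a := n + i + 1) ?_ (by positivity)
      have h3 : (n + i + 1) * ((ν : ℝ) - (2 * i + 1)) ≤ (ν - i) * n := by
        nlinarith [mul_le_mul_of_nonneg_right hn (by positivity : (0 : ℝ) ≤ (i : ℝ) + 1),
          (by positivity : (0 : ℝ) ≤ (2 * i + 1) * (i + 1))]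
      have h4 := mul_le_mul_of_nonneg_right h3 b0
      linarith
    · refine sum_basis_comp_le hy (fun i hi j hj hij => ?_) fun i hi => by omega
      simp only [Finset.coe_range, mem_Iio] at hi hj hij
      omega

/-! ### Block majorants -/

/-- The integers with integer square root `j`. -/
def block (j : ℕ) : Finset ℕ := Finset.Ico (j * j) ((j + 1) * (j + 1))

theorem mem_block {j ν : ℕ} : ν ∈ block j ↔ Nat.sqrt ν = j := by
  rw [block, Finset.mem_Ico, Nat.eq_sqrt.symm.trans eq_comm |>.symm]

theorem card_block (j : ℕ) : (block j).card = 2 * j + 1 := by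
  rw [block, Nat.card_Ico]
  have : (j + 1) * (j + 1) = j * j + (2 * j + 1) := by ring
  omega

theorem sum_block (a : ℕ → ℝ) (N : ℕ) :
    ∑ j ∈ Finset.range N, ∑ ν ∈ block j, a ν = ∑ ν ∈ Finset.range (N * N), a ν := by
  induction N with
  | zero => simp
  | succ N ih =>
    rw [Finset.sum_range_succ, ih, block, Finset.sum_range_add_sum_Ico]
    exact Nat.mul_le_mul (Nat.le_succ N) (Nat.le_succ N)

/-- The majorant is the block maximum. Away from the mode, monotonicity bounds it by the average
over the neighbouring block on the side of the mode; near the mode the local bound `C` is used. -/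
theorem exists_block_majorant {a : ℕ → ℝ} (h0 : ∀ ν, 0 ≤ a ν) {M : ℕ}
    (hmono : ∀ ν < M, a ν ≤ a (ν + 1)) (hanti : ∀ ν, M ≤ ν → a (ν + 1) ≤ a ν)
    (hsum : ∀ N, ∑ ν ∈ Finset.range N, a ν ≤ 1) {C : ℝ}
    (hC : ∀ ν, (2 * (Nat.sqrt ν : ℝ) + 1) * a ν ≤ C) :
    ∃ P : ℕ → ℝ, (∀ j, 0 ≤ P j) ∧ (∀ ν, a ν ≤ P (Nat.sqrt ν)) ∧
      ∀ N, ∑ j ∈ Finset.range N, (2 * (j : ℝ) + 1) * P j ≤ 4 + 3 * C := by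
  have hne : ∀ j, (block j).Nonempty := fun j => ⟨j * j, mem_block.2 (Nat.sqrt_eq j)⟩
  choose m hm hmax using fun j => Finset.exists_max_image (block j) a (hne j)
  have hmj : ∀ j, Nat.sqrt (m j) = j := fun j => mem_block.1 (hm j)
  have hC0 : 0 ≤ C := (mul_nonneg (by positivity) (h0 0)).trans (hC 0)
  have hmono' : ∀ μ ν, μ ≤ ν → ν ≤ M → a μ ≤ a ν := by
    intro μ ν hμ
    induction ν, hμ using Nat.le_induction with
    | base => exact fun _ => le_rfl
    | succ n _ ih => exact fun h => (ih (by omega)).trans (hmono n (by omega))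
  have hanti' : ∀ μ ν, μ ≤ ν → M ≤ μ → a ν ≤ a μ := by
    intro μ ν hμ hM
    induction ν, hμ using Nat.le_induction with
    | base => exact le_rfl
    | succ n hn ih => exact (hanti n (by omega)).trans ih
  set J := Nat.sqrt M with hJ
  have hlt : ∀ {μ ν : ℕ}, Nat.sqrt μ < Nat.sqrt ν → μ < ν := fun h => by
    by_contra hc
    exact absurd (Nat.sqrt_le_sqrt (not_lt.1 hc)) (not_le.2 h)
  have hblock : ∀ j i : ℕ, (∀ ν ∈ block i, a (m j) ≤ a ν) →
      (2 * (i : ℝ) + 1) * a (m j) ≤ ∑ ν ∈ block i, a ν := by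
    intro j i h
    have := Finset.card_nsmul_le_sum (block i) a (a (m j)) h
    rw [card_block, nsmul_eq_mul] at this
    exact_mod_cast this
  have hSnn : ∀ j, 0 ≤ ∑ ν ∈ block j, a ν := fun j => Finset.sum_nonneg fun ν _ => h0 ν
  -- Below the mode the next block is longer; above it, `2j + 1 ≤ 3(2(j - 1) + 1)` gives the factor
  -- 3. The blocks `J - 1, J, J + 1` are exceptional because the neighbour used might contain the
  -- mode. Summation yields `1 + 3 + 3C`.
  have key : ∀ j : ℕ, (2 * (j : ℝ) + 1) * a (m j) ≤ ∑ ν ∈ block (j + 1), a ν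
      + (if j = 0 then 0 else 3 * ∑ ν ∈ block (j - 1), a ν)
      + if j ∈ Finset.Icc (J - 1) (J + 1) then C else 0 := by
    intro j
    have hn1 : (0 : ℝ) ≤ if j = 0 then 0 else 3 * ∑ ν ∈ block (j - 1), a ν := by
      split_ifs
      · exact le_rfl
      · exact mul_nonneg (by norm_num) (hSnn _)
    have hn2 : (0 : ℝ) ≤ if j ∈ Finset.Icc (J - 1) (J + 1) then C else 0 := by
      split_ifs
      · exact hC0
      · exact le_rfl
    by_cases hj : j ∈ Finset.Icc (J - 1) (J + 1)
    · have h1 := hC (m j)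
      rw [hmj] at h1
      rw [if_pos hj]
      linarith [hSnn (j + 1)]
    · rw [Finset.mem_Icc] at hj
      rcases lt_or_ge j J with h | h
      · have h1 := hblock j (j + 1) fun ν hν => by
          rw [mem_block] at hν
          exact hmono' _ _ (hlt (by rw [hν, hmj]; omega)).le (hlt (by rw [hν]; omega)).le
        push_cast at h1
        linarith [h0 (m j)]
      · have h1 := hblock j (j - 1) fun ν hν => by
          rw [mem_block] at hν
          exact hanti' _ _ (hlt (by rw [hν, hmj]; omega)).le (hlt (by rw [hν]; omega)).le
        obtain ⟨i, rfl⟩ : ∃ i, j = i + 1 := ⟨j - 1, by omega⟩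
        rw [if_neg (Nat.succ_ne_zero i)]
        rw [Nat.add_sub_cancel] at h1 ⊢
        push_cast
        have : 0 ≤ (i : ℝ) * a (m (i + 1)) := mul_nonneg (by positivity) (h0 _)
        linarith [hSnn (i + 1 + 1)]
  refine ⟨fun j => a (m j), fun j => h0 _, fun ν => hmax _ ν (mem_block.2 rfl), fun N => ?_⟩
  refine (Finset.sum_le_sum fun j _ => key j).trans ?_
  rw [Finset.sum_add_distrib, Finset.sum_add_distrib]
  have s1 : ∑ j ∈ Finset.range N, ∑ ν ∈ block (j + 1), a ν ≤ 1 := by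
    have := hsum ((N + 1) * (N + 1))
    rw [← sum_block, Finset.sum_range_succ'] at this
    linarith [hSnn 0]
  have s2 : ∑ j ∈ Finset.range N, (if j = 0 then 0 else 3 * ∑ ν ∈ block (j - 1), a ν) ≤ 3 := by
    cases N with
    | zero => simp
    | succ N =>
      rw [Finset.sum_range_succ']
      simp only [Nat.add_sub_cancel, if_neg (Nat.succ_ne_zero _), if_true, add_zero]
      rw [← Finset.mul_sum, sum_block]
      linarith [hsum (N * N)]
  have s3 : ∑ j ∈ Finset.range N, (if j ∈ Finset.Icc (J - 1) (J + 1) then C else 0) ≤ 3 * C := by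
    rw [← Finset.sum_filter, Finset.sum_const, nsmul_eq_mul]
    refine mul_le_mul_of_nonneg_right ?_ hC0
    have : (Finset.filter (fun j => j ∈ Finset.Icc (J - 1) (J + 1)) (Finset.range N)).card ≤ 3 := by
      refine (Finset.card_le_card (t := Finset.Icc (J - 1) (J + 1)) fun j hj =>
        (Finset.mem_filter.1 hj).2).trans ?_
      rw [Nat.card_Icc]
      omega
    exact_mod_cast this
  linarith

theorem exists_half_majorant (k : ℕ) {y : ℝ} (hy : y ∈ Icc (0 : ℝ) 1) :
    ∃ P : ℕ → ℝ, (∀ j, 0 ≤ P j) ∧ (∀ ν, 2 * ν ≤ k → basis k ν y ≤ P (Nat.sqrt ν)) ∧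
      ∀ N, ∑ j ∈ Finset.range N, (2 * (j : ℝ) + 1) * P j ≤ 22 := by
  set a : ℕ → ℝ := fun ν => if 2 * ν ≤ k then basis k ν y else 0 with ha
  have hle : ∀ ν, 2 * ν ≤ k → a ν = basis k ν y := fun ν h => if_pos h
  have hgt : ∀ ν, ¬ 2 * ν ≤ k → a ν = 0 := fun ν h => if_neg h
  have h0 : ∀ ν, 0 ≤ a ν := by
    intro ν
    by_cases h : 2 * ν ≤ k
    · rw [hle ν h]; exact basis_nonneg hy k ν
    · rw [hgt ν h]
  have hky : 0 ≤ ((k : ℝ) + 1) * y := mul_nonneg (by positivity) hy.1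
  suffices hmain : ∃ P : ℕ → ℝ, (∀ j, 0 ≤ P j) ∧ (∀ ν, a ν ≤ P (Nat.sqrt ν)) ∧
      ∀ N, ∑ j ∈ Finset.range N, (2 * (j : ℝ) + 1) * P j ≤ 4 + 3 * 6 by
    obtain ⟨P, hP0, hP, hPs⟩ := hmain
    refine ⟨P, hP0, fun ν hν => ?_, fun N => (hPs N).trans (by norm_num)⟩
    rw [← hle ν hν]
    exact hP ν
  -- Cutting the weights to zero beyond `k/2`, where the local bound is not available, preserves
  -- unimodality and moves the mode to this minimum.
  refine exists_block_majorant h0 (M := min ⌊((k : ℝ) + 1) * y⌋₊ (k / 2)) (fun ν hν => ?_)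
    (fun ν hν => ?_) (fun N => ?_) (fun ν => ?_)
  · rw [lt_min_iff] at hν
    rw [hle ν (by omega), hle (ν + 1) (by omega)]
    refine basis_le_basis_succ hy (by omega) ?_
    have := (Nat.le_floor_iff hky).1 hν.1
    exact_mod_cast this
  · by_cases h : 2 * (ν + 1) ≤ k
    · rw [hle ν (by omega), hle (ν + 1) h]
      refine basis_succ_le_basis hy (by omega) ?_
      rw [min_le_iff] at hν
      exact ((Nat.floor_lt hky).1 (by omega : ⌊((k : ℝ) + 1) * y⌋₊ < ν + 1)).le.trans
        (by push_cast; exact le_rfl)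
    · rw [hgt _ h]
      exact h0 ν
  · rw [← sum_basis k y]
    calc ∑ ν ∈ Finset.range N, a ν ≤ ∑ ν ∈ Finset.range N, if ν < k + 1 then basis k ν y else 0 := by
          refine Finset.sum_le_sum fun ν _ => ?_
          by_cases h : 2 * ν ≤ k
          · rw [hle ν h, if_pos (by omega)]
          · rw [hgt ν h]
            split_ifs
            · exact basis_nonneg hy k ν
            · exact le_rfl
      _ ≤ _ := by
          rw [← Finset.sum_filter]
          refine Finset.sum_le_sum_of_subset_of_nonneg (fun ν hν => ?_)
            fun ν _ _ => basis_nonneg hy k ν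
          exact Finset.mem_range.2 (Finset.mem_filter.1 hν).2
  · by_cases h : 2 * ν ≤ k
    · rw [hle ν h]
      exact sqrt_mul_basis_le h hy
    · rw [hgt ν h, mul_zero]
      norm_num

/-- Label of the block of a lattice index: the integer square root of its distance to the nearer
end of `{0, …, k}`, and which end that is. -/
def label {k : ℕ} (v : Fin (k + 1)) : Fin (k + 1) × Bool :=
  if 2 * (v : ℕ) ≤ k then (⟨Nat.sqrt v, (Nat.sqrt_le_self _).trans_lt v.2⟩, false)
  else (⟨Nat.sqrt (k - v), ((Nat.sqrt_le_self _).trans (Nat.sub_le _ _)).trans_lt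
    (Nat.lt_succ_self k)⟩, true)

/-- The upper half is the lower half for `1 - y`, by the symmetry of the weights; `44 = 22 + 22`. -/
theorem exists_label_majorant (k : ℕ) {y : ℝ} (hy : y ∈ Icc (0 : ℝ) 1) :
    ∃ P : Fin (k + 1) × Bool → ℝ, (∀ b, 0 ≤ P b) ∧ (∀ v : Fin (k + 1), basis k v y ≤ P (label v)) ∧
      ∑ b, (2 * ((b.1 : ℕ) : ℝ) + 1) * P b ≤ 44 := by
  obtain ⟨P, hP0, hP, hPs⟩ := exists_half_majorant k hy
  obtain ⟨Q, hQ0, hQ, hQs⟩ := exists_half_majorant k (y := 1 - y)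
    ⟨by linarith [hy.2], by linarith [hy.1]⟩
  refine ⟨fun b => if b.2 then Q b.1 else P b.1, fun b => ?_, fun v => ?_, ?_⟩
  · dsimp only
    split_ifs
    · exact hQ0 _
    · exact hP0 _
  · have hv : (v : ℕ) ≤ k := Nat.lt_succ_iff.1 v.2
    by_cases h : 2 * (v : ℕ) ≤ k
    · simp only [label, if_pos h]
      exact hP v h
    · simp only [label, if_neg h]
      rw [← basis_flip hv]
      exact hQ _ (by omega)
  · rw [Fintype.sum_prod_type]
    simp only [Fintype.sum_bool, if_true, Bool.false_eq_true, if_false, Finset.sum_add_distrib]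
    rw [Fin.sum_univ_eq_sum_range (fun j => (2 * (j : ℝ) + 1) * Q j),
      Fin.sum_univ_eq_sum_range (fun j => (2 * (j : ℝ) + 1) * P j)]
    linarith [hPs (k + 1), hQs (k + 1)]

theorem card_filter_label_le {k : ℕ} (b : Fin (k + 1) × Bool) :
    (Finset.univ.filter fun v : Fin (k + 1) => label v = b).card ≤ 2 * (b.1 : ℕ) + 1 := by
  rw [← card_block]
  obtain ⟨j, c⟩ := b
  cases c with
  | false =>
    have key : ∀ v : Fin (k + 1), label v = (j, false) → Nat.sqrt v = j := by
      intro v hv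
      unfold label at hv
      split_ifs at hv with h
      · simpa using congrArg (fun b => ((b.1 : Fin (k + 1)) : ℕ)) hv
      · simp at hv
    refine Finset.card_le_card_of_injOn (fun v => (v : ℕ)) (fun v hv => ?_)
      fun v _ w _ hvw => Fin.ext hvw
    exact mem_block.2 (key v (by simpa using hv))
  | true =>
    have key : ∀ v : Fin (k + 1), label v = (j, true) → Nat.sqrt (k - v) = j := by
      intro v hv
      unfold label at hv
      split_ifs at hv with h
      · simp at hv
      · simpa using congrArg (fun b => ((b.1 : Fin (k + 1)) : ℕ)) hv
    refine Finset.card_le_card_of_injOn (fun v => k - (v : ℕ)) (fun v hv => ?_)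
      fun v _ w _ hvw => Fin.ext ?_
    · exact mem_block.2 (key v (by simpa using hv))
    · have := v.2
      have := w.2
      dsimp only at hvw
      omega

/-- The lattice indices whose coordinates carry given labels. -/
def cell {l k : ℕ} (b : Fin l → Fin (k + 1) × Bool) : Finset (Lattice l k) :=
  Finset.univ.filter fun ν => (fun i => label (ν i)) = b

/-- The nominal size of a cell. -/
def cellSize {l k : ℕ} (b : Fin l → Fin (k + 1) × Bool) : ℕ := ∏ i, (2 * ((b i).1 : ℕ) + 1)

theorem card_cell_le {l k : ℕ} (b : Fin l → Fin (k + 1) × Bool) : (cell b).card ≤ cellSize b := by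
  have : cell b = Fintype.piFinset fun i => Finset.univ.filter fun v => label v = b i := by
    ext ν
    simp [cell, funext_iff]
  rw [this, Fintype.card_piFinset]
  exact Finset.prod_le_prod' fun i _ => card_filter_label_le (b i)

/-- Once the weights are replaced by majorants constant on cells, only cell sums of `|a ν|` remain,
and the sum over cells factorises over the coordinates. -/
theorem abs_evaluate_one_le_of_cell {l k : ℕ} {a : Lattice l k → ℝ} {G : ℝ} (hG : 0 ≤ G)
    (ha : ∀ b : Fin l → Fin (k + 1) × Bool, ∑ ν ∈ cell b, |a ν| ≤ G * cellSize b) :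
    ∀ z ∈ cube l, |evaluate 1 a z| ≤ 44 ^ l * G := by
  intro z hz
  choose P hP0 hP hPs using fun i => exists_label_majorant k (apply_mem_Icc hz i)
  have h1 : |evaluate 1 a z| ≤ ∑ ν : Lattice l k, |a ν| * ∏ i, P i (label (ν i)) := by
    refine (Finset.abs_sum_le_sum_abs _ _).trans (Finset.sum_le_sum fun ν _ => ?_)
    simp only [iteratedBasis_one]
    have hb : ∀ i ∈ Finset.univ, 0 ≤ basis k (ν i) (z i) := fun i _ =>
      basis_nonneg (apply_mem_Icc hz i) k _
    rw [abs_mul, abs_of_nonneg (Finset.prod_nonneg hb)]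
    exact mul_le_mul_of_nonneg_left (Finset.prod_le_prod hb fun i _ => hP i (ν i)) (abs_nonneg _)
  refine h1.trans ?_
  rw [← Finset.sum_fiberwise Finset.univ (fun ν : Lattice l k => fun i => label (ν i))]
  calc _ = ∑ b : Fin l → Fin (k + 1) × Bool, (∑ ν ∈ cell b, |a ν|) * ∏ i, P i (b i) := by
        refine Finset.sum_congr rfl fun b _ => ?_
        rw [Finset.sum_mul]
        refine Finset.sum_congr rfl fun ν hν => ?_
        have := (Finset.mem_filter.1 hν).2
        rw [← this]
    _ ≤ ∑ b : Fin l → Fin (k + 1) × Bool, G * ∏ i, ((2 * (((b i).1 : ℕ) : ℝ) + 1) * P i (b i)) := by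
        refine Finset.sum_le_sum fun b _ => ?_
        rw [Finset.prod_mul_distrib, ← mul_assoc]
        refine mul_le_mul_of_nonneg_right ?_ (Finset.prod_nonneg fun i _ => hP0 i _)
        have := ha b
        rw [cellSize] at this
        exact_mod_cast this
    _ = G * ∏ i, ∑ b, (2 * ((b.1 : ℕ) : ℝ) + 1) * P i b := by
        rw [← Finset.mul_sum, Finset.prod_univ_sum, Fintype.piFinset_univ]
    _ ≤ G * 44 ^ l := by
        refine mul_le_mul_of_nonneg_left ?_ hG
        have h2 : ∏ i : Fin l, ∑ b, (2 * ((b.1 : ℕ) : ℝ) + 1) * P i b ≤ ∏ _i : Fin l, (44 : ℝ) :=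
          Finset.prod_le_prod (fun i _ => Finset.sum_nonneg fun b _ =>
            mul_nonneg (by positivity) (hP0 i b)) fun i _ => hPs i
        simpa using h2
    _ = _ := mul_comm _ _

/-! ### Laplace noise -/

theorem integral_exp_neg_mul_abs {c : ℝ} (hc : 0 < c) : ∫ x : ℝ, Real.exp (-(c * |x|)) = 2 / c := by
  rw [integral_comp_abs (f := fun x => Real.exp (-(c * x)))]
  have := integral_exp_mul_Ioi (neg_lt_zero.2 hc) 0
  simp only [neg_mul, mul_zero, Real.exp_zero] at this
  rw [this]
  field_simp

theorem lintegral_exp_neg_mul_abs {c : ℝ} (hc : 0 < c) :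
    ∫⁻ x : ℝ, ENNReal.ofReal (Real.exp (-(c * |x|))) = ENNReal.ofReal (2 / c) := by
  rw [← integral_exp_neg_mul_abs hc, ofReal_integral_eq_lintegral_ofReal]
  · refine Integrable.of_integral_ne_zero ?_
    rw [integral_exp_neg_mul_abs hc]
    positivity
  · exact Filter.Eventually.of_forall fun x => (Real.exp_pos _).le

/-- The density of the Laplace distribution centred at `c`. -/
noncomputable def laplaceDensity (b c x : ℝ) : ℝ≥0∞ := ENNReal.ofReal (Real.exp (-|x - c| / b) / (2 * b))

theorem measurable_laplaceDensity (b c : ℝ) : Measurable (laplaceDensity b c) := by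
  unfold laplaceDensity
  fun_prop

theorem map_laplace {b : ℝ} (hb : 0 < b) (c : ℝ) :
    (laplace b).map (fun x => c + x) = volume.withDensity (laplaceDensity b c) := by
  ext A hA
  have hm : Measurable fun x : ℝ => c + x := by fun_prop
  rw [Measure.map_apply hm hA, laplace, if_neg hb.ne', withDensity_apply _ (hm hA),
    withDensity_apply _ hA, ← lintegral_indicator (hm hA), ← lintegral_indicator hA,
    ← lintegral_add_left_eq_self (A.indicator (laplaceDensity b c)) c]
  refine lintegral_congr fun x => ?_
  by_cases hx : c + x ∈ A
  · rw [indicator_of_mem (show x ∈ (fun x : ℝ => c + x) ⁻¹' A from hx), indicator_of_mem hx]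
    simp [laplaceDensity]
  · rw [indicator_of_notMem (show x ∉ (fun x : ℝ => c + x) ⁻¹' A from hx), indicator_of_notMem hx]

theorem isProbabilityMeasure_laplace {b : ℝ} (hb : 0 < b) : IsProbabilityMeasure (laplace b) := by
  constructor
  rw [laplace, if_neg hb.ne', withDensity_apply _ MeasurableSet.univ, Measure.restrict_univ]
  have : ∀ x : ℝ, ENNReal.ofReal (Real.exp (-|x| / b) / (2 * b))
      = ENNReal.ofReal (Real.exp (-(b⁻¹ * |x|))) * ENNReal.ofReal (2 * b)⁻¹ := by
    intro x
    rw [← ENNReal.ofReal_mul (Real.exp_pos _).le]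
    congr 2
    rw [← mul_neg, div_eq_inv_mul]
  simp only [this]
  rw [lintegral_mul_const _ (by fun_prop), lintegral_exp_neg_mul_abs (inv_pos.2 hb),
    ← ENNReal.ofReal_mul (by positivity)]
  rw [← ENNReal.ofReal_one]
  congr 1
  field_simp

theorem lintegral_exp_abs_laplace {b : ℝ} (hb : 0 < b) :
    ∫⁻ x, ENNReal.ofReal (Real.exp (|x| / (2 * b))) ∂laplace b = 2 := by
  rw [laplace, if_neg hb.ne', lintegral_withDensity_eq_lintegral_mul _ (by fun_prop) (by fun_prop)]
  have : ∀ x : ℝ, ((fun x => ENNReal.ofReal (Real.exp (-|x| / b) / (2 * b)))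
      * fun x => ENNReal.ofReal (Real.exp (|x| / (2 * b)))) x
      = ENNReal.ofReal (Real.exp (-((2 * b)⁻¹ * |x|))) * ENNReal.ofReal (2 * b)⁻¹ := by
    intro x
    rw [Pi.mul_apply, ← ENNReal.ofReal_mul (by positivity), ← ENNReal.ofReal_mul (by positivity),
      div_mul_eq_mul_div, ← Real.exp_add, div_eq_mul_inv]
    congr 3
    field_simp
    ring
  simp only [this]
  rw [lintegral_mul_const _ (by fun_prop), lintegral_exp_neg_mul_abs (by positivity),
    ← ENNReal.ofReal_mul (by positivity)]
  have h2 : (2 : ℝ≥0∞) = ENNReal.ofReal 2 := by norm_num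
  rw [h2]
  congr 1
  field_simp

theorem lintegral_pi_prod {ι : Type*} [Fintype ι] {μ : ι → Measure ℝ}
    [∀ i, IsProbabilityMeasure (μ i)] {f : ι → ℝ → ℝ≥0∞} (hf : ∀ i, Measurable (f i)) :
    ∫⁻ x, ∏ i, f i (x i) ∂Measure.pi μ = ∏ i, ∫⁻ t, f i t ∂μ i := by
  rw [ProbabilityTheory.lintegral_prod_eq_prod_lintegral_of_indepFun Finset.univ
    (fun i (x : ι → ℝ) => f i (x i))
    (ProbabilityTheory.iIndepFun_pi fun i => (hf i).aemeasurable)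
    fun i => (hf i).comp (measurable_pi_apply i)]
  refine Finset.prod_congr rfl fun i _ => ?_
  exact (measurePreserving_eval μ i).lintegral_comp (hf i)

/-- Chernoff's bound with `exp(|Z|/(2b))`, whose mean is 2; the `log 2` in the threshold pays for
the resulting `2^N`. -/
theorem pi_laplace_sum_abs_gt_le {ι : Type*} [Fintype ι] {b : ℝ} (hb : 0 < b) (c : Finset ι)
    {N : ℕ} (hN : c.card ≤ N) (s : ℝ) :
    Measure.pi (fun _ : ι => laplace b) {Z | b * (2 * (Real.log 2 + s)) * N < ∑ i ∈ c, |Z i|}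
      ≤ ENNReal.ofReal (Real.exp (-(s * N))) := by
  classical
  have := isProbabilityMeasure_laplace hb
  set g : ι → ℝ → ℝ≥0∞ := fun i x =>
    if i ∈ c then ENNReal.ofReal (Real.exp (|x| / (2 * b))) else 1 with hg
  have hgm : ∀ i, Measurable (g i) := by
    intro i
    simp only [hg]
    split_ifs <;> fun_prop
  have h1 : ∫⁻ Z, ∏ i, g i (Z i) ∂Measure.pi (fun _ : ι => laplace b) = 2 ^ c.card := by
    rw [lintegral_pi_prod hgm]
    have : ∀ i, ∫⁻ t, g i t ∂laplace b = if i ∈ c then 2 else 1 := by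
      intro i
      simp only [hg]
      split_ifs
      · exact lintegral_exp_abs_laplace hb
      · simp
    simp only [this]
    rw [Finset.prod_ite_mem, Finset.univ_inter, Finset.prod_const]
  have h2 : ∀ Z : ι → ℝ, ∏ i, g i (Z i)
      = ENNReal.ofReal (Real.exp ((∑ i ∈ c, |Z i|) / (2 * b))) := by
    intro Z
    simp only [hg]
    rw [Finset.prod_ite_mem, Finset.univ_inter, Finset.sum_div, Real.exp_sum,
      ENNReal.ofReal_prod_of_nonneg fun i _ => (Real.exp_pos _).le]
  have h3 := mul_meas_ge_le_lintegral₀ (μ := Measure.pi fun _ : ι => laplace b)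
    (f := fun Z => ∏ i, g i (Z i))
    (Finset.measurable_prod Finset.univ fun i _ => (hgm i).comp (measurable_pi_apply i)).aemeasurable
    (ENNReal.ofReal (Real.exp ((Real.log 2 + s) * N)))
  rw [h1] at h3
  have h4 : {Z : ι → ℝ | b * (2 * (Real.log 2 + s)) * N < ∑ i ∈ c, |Z i|}
      ⊆ {Z | ENNReal.ofReal (Real.exp ((Real.log 2 + s) * N)) ≤ ∏ i, g i (Z i)} := by
    intro Z hZ
    simp only [mem_ofPred_eq] at hZ ⊢
    rw [h2]
    refine ENNReal.ofReal_le_ofReal (Real.exp_le_exp.2 ?_)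
    rw [le_div_iff₀ (by positivity)]
    linarith
  have h5 : ENNReal.ofReal (Real.exp ((Real.log 2 + s) * N)) * ENNReal.ofReal (Real.exp (-(s * N)))
      = 2 ^ N := by
    rw [← ENNReal.ofReal_mul (Real.exp_pos _).le, ← Real.exp_add]
    have : (Real.log 2 + s) * N + -(s * N) = N * Real.log 2 := by ring
    rw [this, Real.exp_nat_mul, Real.exp_log two_pos, ENNReal.ofReal_pow two_pos.le]
    norm_num
  have h6 : (2 : ℝ≥0∞) ^ c.card ≤ 2 ^ N := pow_le_pow_right₀ (by norm_num) hN
  rw [← h5] at h6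
  have h7 := h3.trans h6
  rw [ENNReal.mul_le_mul_iff_right (by simpa using Real.exp_pos _) ENNReal.ofReal_ne_top] at h7
  exact (measure_mono h4).trans h7

theorem one_add_sum_le_prod {ι : Type*} (s : Finset ι) {x : ι → ℝ} (hx : ∀ i, 0 ≤ x i) :
    1 + ∑ i ∈ s, x i ≤ ∏ i ∈ s, (1 + x i) := by
  classical
  induction s using Finset.induction_on with
  | empty => simp
  | insert i s hi ih =>
    rw [Finset.sum_insert hi, Finset.prod_insert hi]
    have h1 : 0 ≤ ∑ i ∈ s, x i := Finset.sum_nonneg fun i _ => hx i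
    nlinarith [hx i, mul_nonneg (hx i) h1, mul_le_mul_of_nonneg_left ih (hx i)]

/-- Since `∏ (1 + 2j_i) ≥ 1 + 2 ∑ j_i`, the sum is dominated by `exp(-s)` times a product of
geometric series. The 4 per coordinate is two ends times a series of ratio at most `1/2`, whatever
`k` is. -/
theorem sum_exp_neg_mul_cellSize_le (l k : ℕ) {s : ℝ} (hs : 1 ≤ s) :
    ∑ b : Fin l → Fin (k + 1) × Bool, Real.exp (-(s * cellSize b)) ≤ 4 ^ l * Real.exp (-s) := by
  set q : ℝ := Real.exp (-(2 * s)) with hq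
  have hq0 : 0 ≤ q := (Real.exp_pos _).le
  have hq1 : q ≤ 1 / 2 := by
    rw [hq, Real.exp_neg, inv_eq_one_div]
    refine one_div_le_one_div_of_le two_pos ?_
    have := Real.add_one_le_exp (2 * s)
    linarith
  have h1 : ∀ b : Fin l → Fin (k + 1) × Bool,
      Real.exp (-(s * cellSize b)) ≤ Real.exp (-s) * ∏ i, q ^ ((b i).1 : ℕ) := by
    intro b
    have h2 := one_add_sum_le_prod Finset.univ (x := fun i => 2 * (((b i).1 : ℕ) : ℝ))
      fun i => by positivity
    have h3 : ((cellSize b : ℕ) : ℝ) = ∏ i, (1 + 2 * (((b i).1 : ℕ) : ℝ)) := by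
      rw [cellSize]
      push_cast
      exact Finset.prod_congr rfl fun i _ => add_comm _ _
    have h4 : ∏ i, q ^ ((b i).1 : ℕ) = Real.exp (∑ i, -(s * (2 * (((b i).1 : ℕ) : ℝ)))) := by
      rw [Real.exp_sum]
      refine Finset.prod_congr rfl fun i _ => ?_
      rw [hq, ← Real.exp_nat_mul]
      congr 1
      ring
    rw [h3, h4, ← Real.exp_add]
    refine Real.exp_le_exp.2 ?_
    rw [Finset.sum_neg_distrib, ← Finset.mul_sum]
    have := mul_le_mul_of_nonneg_left h2 (by linarith : 0 ≤ s)
    linarith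
  refine (Finset.sum_le_sum fun b _ => h1 b).trans ?_
  have h5 : ∑ b : Fin l → Fin (k + 1) × Bool, ∏ i, q ^ ((b i).1 : ℕ)
      = ∏ _i : Fin l, ∑ b : Fin (k + 1) × Bool, q ^ (b.1 : ℕ) := by
    rw [Finset.prod_univ_sum, Fintype.piFinset_univ]
  have h6 : ∑ b : Fin (k + 1) × Bool, q ^ (b.1 : ℕ) ≤ 4 := by
    rw [Fintype.sum_prod_type]
    simp only [Fintype.sum_bool, Finset.sum_add_distrib]
    rw [Fin.sum_univ_eq_sum_range (fun j => q ^ j)]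
    have : ∑ j ∈ Finset.range (k + 1), q ^ j ≤ 2 :=
      (Finset.sum_le_sum fun j _ => pow_le_pow_left₀ hq0 hq1 j).trans (sum_geometric_two_le _)
    linarith
  rw [← Finset.mul_sum, h5, Finset.prod_const, Finset.card_univ, Fintype.card_fin, mul_comm]
  exact mul_le_mul_of_nonneg_right
    (pow_le_pow_left₀ (Finset.sum_nonneg fun _ _ => pow_nonneg hq0 _) h6 l) (Real.exp_pos _).le

/-- With probability at least `1 - β`, all cells have averages of size `O(b log (1/β))`. -/
theorem le_pi_laplace_cell {l : ℕ} (hl : 0 < l) (k : ℕ) {b β : ℝ} (hb : 0 < b) (hβ0 : 0 < β)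
    (hβ1 : β < 1) :
    ENNReal.ofReal (1 - β) ≤ Measure.pi (fun _ : Lattice l k => laplace b)
      {Z | ∀ c : Fin l → Fin (k + 1) × Bool, ∑ ν ∈ cell c, |Z ν|
        ≤ b * (2 * (Real.log 2 + (l * Real.log 4 + Real.log (1 / β)))) * cellSize c} := by
  have := isProbabilityMeasure_laplace hb
  -- Chosen so that `4^l exp(-s) = β`.
  set s : ℝ := l * Real.log 4 + Real.log (1 / β) with hs
  set μ := Measure.pi (fun _ : Lattice l k => laplace b) with hμ
  have hlog4 : 1 ≤ Real.log 4 := by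
    have : (4 : ℝ) = 2 ^ 2 := by norm_num
    rw [this, Real.log_pow]
    have := Real.log_two_gt_d9
    push_cast
    linarith
  have hlogβ : 0 ≤ Real.log (1 / β) := Real.log_nonneg ((one_le_div hβ0).2 hβ1.le)
  have hs1 : 1 ≤ s := by
    have : (1 : ℝ) ≤ l := by exact_mod_cast hl
    nlinarith
  set good := {Z : Lattice l k → ℝ | ∀ c : Fin l → Fin (k + 1) × Bool, ∑ ν ∈ cell c, |Z ν|
        ≤ b * (2 * (Real.log 2 + s)) * cellSize c} with hgood
  have hbad : μ goodᶜ ≤ ENNReal.ofReal β := by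
    have h1 : goodᶜ = ⋃ c : Fin l → Fin (k + 1) × Bool,
        {Z | b * (2 * (Real.log 2 + s)) * cellSize c < ∑ ν ∈ cell c, |Z ν|} := by
      ext Z
      simp [hgood]
    rw [h1]
    refine (measure_iUnion_fintype_le μ _).trans ?_
    refine (Finset.sum_le_sum fun c _ => pi_laplace_sum_abs_gt_le hb (cell c) (card_cell_le c) s).trans ?_
    rw [← ENNReal.ofReal_sum_of_nonneg fun c _ => (Real.exp_pos _).le]
    refine ENNReal.ofReal_le_ofReal ((sum_exp_neg_mul_cellSize_le l k hs1).trans (le_of_eq ?_))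
    rw [hs, Real.exp_neg, Real.exp_add, Real.exp_nat_mul, Real.exp_log (by norm_num),
      Real.exp_log (by positivity)]
    field_simp
  rw [ENNReal.ofReal_sub _ hβ0.le, ENNReal.ofReal_one, tsub_le_iff_right]
  calc (1 : ℝ≥0∞) = μ univ := measure_univ.symm
    _ ≤ μ good + μ goodᶜ := by
      rw [← union_compl_self good]
      exact measure_union_le _ _
    _ ≤ _ := by gcongr

/-! ### Advanced composition -/

theorem nnnorm_sub_neg_div_two_sq {e : ℝ} (he : 0 ≤ e) :
    (((‖e - -e‖₊ / 2) ^ 2 : NNReal) : ℝ) = e ^ 2 := by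
  push_cast
  rw [sub_neg_eq_add, Real.norm_of_nonneg (by linarith)]
  ring

/-- The mean of a privacy loss bounded by `e` is at most `e² / 2`. -/
theorem integral_privacyLoss_le {p : Measure ℝ} [IsProbabilityMeasure p] {L : ℝ → ℝ}
    (hL : Measurable L) {e : ℝ} (hbd : ∀ x, |L x| ≤ e)
    (h1 : ∫⁻ x, ENNReal.ofReal (Real.exp (-L x)) ∂p = 1) :
    ∫ x, L x ∂p ≤ e ^ 2 / 2 := by
  have he : 0 ≤ e := (abs_nonneg _).trans (hbd 0)
  have hsub := ProbabilityTheory.hasSubgaussianMGF_of_mem_Icc (μ := p) (a := -e) (b := e)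
    hL.aemeasurable (Filter.Eventually.of_forall fun x => abs_le.1 (hbd x))
  -- As `exp(-L)` integrates to 1, the centred moment generating function at `-1` is exactly the
  -- exponential of the mean, so Hoeffding's lemma bounds the mean.
  have h2 := hsub.mgf_le (-1)
  rw [nnnorm_sub_neg_div_two_sq he] at h2
  have h3 : ∫ x, Real.exp (-L x) ∂p = 1 := by
    rw [integral_eq_lintegral_of_nonneg_ae (Filter.Eventually.of_forall fun x => (Real.exp_pos _).le)
      (by fun_prop), h1, ENNReal.toReal_one]
  have h4 : ProbabilityTheory.mgf (fun x => L x - ∫ z, L z ∂p) p (-1)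
      = Real.exp (∫ z, L z ∂p) := by
    have : ∀ x, Real.exp (-1 * (L x - ∫ z, L z ∂p))
        = Real.exp (∫ z, L z ∂p) * Real.exp (-L x) := by
      intro x
      rw [← Real.exp_add]
      congr 1
      ring
    simp only [ProbabilityTheory.mgf, this]
    rw [integral_const_mul, h3, mul_one]
  rw [h4, Real.exp_le_exp] at h2
  linarith

theorem pi_withDensity {ι : Type*} [Fintype ι] {p q : ι → Measure ℝ}
    [∀ i, IsProbabilityMeasure (p i)] [∀ i, IsProbabilityMeasure (q i)] {f : ι → ℝ → ℝ≥0∞}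
    (hf : ∀ i, Measurable (f i)) (hq : ∀ i, q i = (p i).withDensity (f i)) :
    Measure.pi q = (Measure.pi p).withDensity fun x => ∏ i, f i (x i) := by
  refine Measure.pi_eq fun s hs => ?_
  rw [withDensity_apply _ (MeasurableSet.univ_pi hs), ← lintegral_indicator (MeasurableSet.univ_pi hs)]
  have : ∀ x : ι → ℝ, (univ.pi s).indicator (fun x => ∏ i, f i (x i)) x
      = ∏ i, (s i).indicator (f i) (x i) := by
    intro x
    by_cases hx : x ∈ univ.pi s
    · rw [indicator_of_mem hx]
      exact Finset.prod_congr rfl fun i _ => (indicator_of_mem (hx i (mem_univ i)) _).symm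
    · rw [indicator_of_notMem hx]
      simp only [mem_univ_pi, not_forall] at hx
      obtain ⟨i, hi⟩ := hx
      exact (Finset.prod_eq_zero (Finset.mem_univ i) (indicator_of_notMem hi _)).symm
  simp only [this]
  rw [lintegral_pi_prod fun i => (hf i).indicator (hs i)]
  refine Finset.prod_congr rfl fun i _ => ?_
  rw [lintegral_indicator (hs i), hq i, withDensity_apply _ (hs i)]

/-- Advanced composition for independent mechanisms with bounded privacy losses `L i`. -/
theorem pi_le_exp_mul_pi_add {ι : Type*} [Fintype ι] {p q : ι → Measure ℝ}
    [∀ i, IsProbabilityMeasure (p i)] [∀ i, IsProbabilityMeasure (q i)] {L : ι → ℝ → ℝ}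
    (hL : ∀ i, Measurable (L i)) {e : ℝ} (he : 0 ≤ e) (hbd : ∀ i x, |L i x| ≤ e)
    (hq : ∀ i, q i = (p i).withDensity fun x => ENNReal.ofReal (Real.exp (-L i x)))
    {ε δ : ℝ} (hε : Fintype.card ι * e ^ 2 / 2 ≤ ε)
    (hδ : Real.exp (-(ε - Fintype.card ι * e ^ 2 / 2) ^ 2 / (2 * (Fintype.card ι * e ^ 2))) ≤ δ)
    {A : Set (ι → ℝ)} (hA : MeasurableSet A) :
    Measure.pi p A ≤ ENNReal.ofReal (Real.exp ε) * Measure.pi q A + ENNReal.ofReal δ := by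
  set n : ℝ := (Fintype.card ι : ℝ) with hn
  have hmean : ∀ i, ∫ x, L i x ∂p i ≤ e ^ 2 / 2 := fun i =>
    integral_privacyLoss_le (hL i) (hbd i) (by
      have h := measure_univ (μ := q i)
      rwa [hq i, withDensity_apply _ MeasurableSet.univ, Measure.restrict_univ] at h)
  have hLm : ∀ i, Measurable fun x : ι → ℝ => L i (x i) := fun i =>
    (hL i).comp (measurable_pi_apply i)
  have hSm : Measurable fun x : ι → ℝ => ∑ i, L i (x i) :=
    Finset.measurable_sum _ fun i _ => hLm i
  -- The event of large total loss: it has `p`-mass at most `δ`, and off it the density of `q` with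
  -- respect to `p` exceeds `exp(-ε)`.
  set B : Set (ι → ℝ) := {x | ε ≤ ∑ i, L i (x i)} with hB
  have hBm : MeasurableSet B := measurableSet_le measurable_const hSm
  have hInt : ∀ i, ∫ x, L i (x i) ∂Measure.pi p = ∫ t, L i t ∂p i := fun i =>
    integral_comp_eval (μ := p) (i := i) (f := L i) (hL i).aestronglyMeasurable
  have hind := ProbabilityTheory.iIndepFun_pi (μ := p)
    (X := fun i t => L i t - ∫ z, L i z ∂p i) fun i => ((hL i).sub_const _).aemeasurable
  have hsub : ∀ i ∈ (Finset.univ : Finset ι), ProbabilityTheory.HasSubgaussianMGF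
      (fun x : ι → ℝ => L i (x i) - ∫ z, L i z ∂p i) ((‖e - -e‖₊ / 2) ^ 2) (Measure.pi p) := by
    intro i _
    have := ProbabilityTheory.hasSubgaussianMGF_of_mem_Icc (μ := Measure.pi p) (a := -e) (b := e)
      (hLm i).aemeasurable (Filter.Eventually.of_forall fun x => abs_le.1 (hbd i (x i)))
    rwa [hInt i] at this
  have hhoef := ProbabilityTheory.HasSubgaussianMGF.measure_sum_ge_le_of_iIndepFun hind hsub
    (ε := ε - n * e ^ 2 / 2) (by linarith)
  have hBδ : Measure.pi p B ≤ ENNReal.ofReal δ := by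
    rw [← ofReal_measureReal (measure_ne_top _ _)]
    refine ENNReal.ofReal_le_ofReal (le_trans (measureReal_mono (fun x hx => ?_)
      (measure_ne_top _ _)) (hhoef.trans (le_trans (le_of_eq ?_) hδ)))
    · rw [hB, mem_ofPred_eq] at hx
      rw [mem_ofPred_eq, Finset.sum_sub_distrib]
      have h1 : ∑ i, ∫ z, L i z ∂p i ≤ ∑ _i : ι, e ^ 2 / 2 := Finset.sum_le_sum fun i _ => hmean i
      rw [Finset.sum_const, Finset.card_univ, nsmul_eq_mul, ← hn] at h1
      linarith
    · rw [Finset.sum_const, Finset.card_univ, nsmul_eq_mul]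
      push_cast [nnnorm_sub_neg_div_two_sq he]
      rw [hn]
  have hmain : Measure.pi p (A \ B) ≤ ENNReal.ofReal (Real.exp ε) * Measure.pi q A := by
    have hdm : ∀ i, Measurable fun x => ENNReal.ofReal (Real.exp (-L i x)) := fun i => by
      have := hL i
      fun_prop
    have hpm : Measurable fun x : ι → ℝ => ∏ i, ENNReal.ofReal (Real.exp (-L i (x i))) :=
      Finset.measurable_prod Finset.univ fun i _ => (hdm i).comp (measurable_pi_apply i)
    rw [pi_withDensity hdm hq, withDensity_apply _ hA, ← lintegral_const_mul _ hpm,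
      ← setLIntegral_one]
    refine (setLIntegral_mono_ae' (hA.diff hBm) (Filter.Eventually.of_forall fun x hx => ?_)).trans
      (lintegral_mono_set sdiff_subset)
    have hx2 : ∑ i, L i (x i) < ε := by
      have := hx.2
      rw [hB, mem_ofPred_eq, not_le] at this
      exact this
    rw [← ENNReal.ofReal_prod_of_nonneg fun i _ => (Real.exp_pos _).le, ← Real.exp_sum,
      ← ENNReal.ofReal_mul (Real.exp_pos _).le, ← Real.exp_add, Finset.sum_neg_distrib]
    rw [← ENNReal.ofReal_one]
    exact ENNReal.ofReal_le_ofReal (Real.one_le_exp (by linarith))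
  calc Measure.pi p A ≤ Measure.pi p (A \ B) + Measure.pi p B := by
        refine (measure_mono fun x hx => ?_).trans (measure_union_le _ _)
        by_cases h : x ∈ B
        · exact Or.inr h
        · exact Or.inl ⟨hx, h⟩
    _ ≤ _ := add_le_add hmain hBδ

/-! ### Privacy of the mechanism -/

theorem abs_sub_le_of_neighbors {X : Type*} {n l : ℕ} {F : (Fin n → X) → (Fin l → ℝ) → ℝ}
    (hF : sensitivity F ≠ ⊤) {D D' : Fin n → X} (h : Neighbors D D') {y : Fin l → ℝ}
    (hy : y ∈ cube l) : |F D y - F D' y| ≤ (sensitivity F).toReal := by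
  have h1 : ENNReal.ofReal |F D y - F D' y| ≤ sensitivity F :=
    le_trans (le_iSup₂_of_le D D' (le_iSup (fun _ : Neighbors D D' => ENNReal.ofReal |F D y - F D' y|) h))
      (le_iSup₂_of_le (f := fun y (_ : y ∈ cube l) => pointSensitivity fun D => F D y) y hy le_rfl)
  exact (ENNReal.ofReal_le_iff_le_toReal hF).1 h1

theorem mechanism_eq_pi {X : Type*} {n l : ℕ} (F : (Fin n → X) → (Fin l → ℝ) → ℝ) (k : ℕ) {b : ℝ}
    (hb : 0 < b) (D : Fin n → X) :
    mechanism F k b D = Measure.pi fun ν : Lattice l k =>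
      (laplace b).map fun x => F D (latticePoint ν) + x := by
  have := isProbabilityMeasure_laplace hb
  have hm : ∀ ν : Lattice l k, AEMeasurable (fun x => F D (latticePoint ν) + x) (laplace b) :=
    fun ν => by fun_prop
  have : ∀ ν : Lattice l k, IsProbabilityMeasure
      ((laplace b).map fun x => F D (latticePoint ν) + x) := fun ν =>
    Measure.isProbabilityMeasure_map (hm ν)
  exact Measure.pi_map_pi hm

theorem map_laplace_eq_withDensity {b : ℝ} (hb : 0 < b) (c c' : ℝ) :
    (laplace b).map (fun x => c' + x) = ((laplace b).map fun x => c + x).withDensity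
      fun x => ENNReal.ofReal (Real.exp (-((|x - c'| - |x - c|) / b))) := by
  rw [map_laplace hb, map_laplace hb, ← withDensity_mul _ (measurable_laplaceDensity b c)
    (by fun_prop)]
  congr 1
  ext x
  rw [Pi.mul_apply, laplaceDensity, laplaceDensity, ← ENNReal.ofReal_mul (by positivity),
    div_mul_eq_mul_div, ← Real.exp_add]
  congr 3
  ring_nf

theorem isDifferentiallyPrivate_mechanism {l : ℕ} {ε δ : ℝ} (hε : 0 < ε) (hδ0 : 0 < δ)
    (hδ1 : δ < 1) (hεδ : ε ≤ 8 * Real.log (1 / δ)) {X : Type*} {n : ℕ}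
    {F : (Fin n → X) → (Fin l → ℝ) → ℝ} (hF : sensitivity F ≠ ⊤) (k : ℕ) :
    IsDifferentiallyPrivate (mechanism F k (scale l k (sensitivity F).toReal ε δ)) ε δ := by
  intro D D' hD A hA
  set S := (sensitivity F).toReal with hS
  have hdiff : ∀ ν : Lattice l k, |F D (latticePoint ν) - F D' (latticePoint ν)| ≤ S := fun ν =>
    abs_sub_le_of_neighbors hF hD (latticePoint_mem_cube ν)
  have hlog : 0 < Real.log (1 / δ) := Real.log_pos ((one_lt_div hδ0).2 hδ1)
  have hS0 : 0 ≤ S := ENNReal.toReal_nonneg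
  -- For zero sensitivity the noise degenerates to a point mass, but neighbouring databases have the
  -- same response law.
  rcases hS0.eq_or_lt with h0 | hpos
  · have heq : mechanism F k (scale l k S ε δ) D = mechanism F k (scale l k S ε δ) D' := by
      have : ∀ ν : Lattice l k, F D (latticePoint ν) = F D' (latticePoint ν) := fun ν => by
        have := hdiff ν
        rw [← h0] at this
        exact sub_eq_zero.1 (abs_eq_zero.1 (le_antisymm this (abs_nonneg _)))
      simp only [mechanism, this]
    rw [heq]
    refine le_add_right (le_mul_of_one_le_left zero_le ?_)
    rw [← ENNReal.ofReal_one]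
    exact ENNReal.ofReal_le_ofReal (Real.one_le_exp hε.le)
  set b := scale l k S ε δ with hbdef
  set N : ℝ := ((k : ℝ) + 1) ^ l with hN
  have hN0 : 0 < N := by positivity
  have hb : 0 < b := by
    rw [hbdef, scale]
    positivity
  have hprob := isProbabilityMeasure_laplace hb
  have : ∀ c : ℝ, IsProbabilityMeasure ((laplace b).map fun x => c + x) := fun c =>
    Measure.isProbabilityMeasure_map (by fun_prop)
  rw [mechanism_eq_pi F k hb, mechanism_eq_pi F k hb]
  have hcard : (Fintype.card (Lattice l k) : ℝ) = N := by
    rw [Fintype.card_fun, Fintype.card_fin, Fintype.card_fin]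
    push_cast
    rfl
  have hNe : N * (S / b) ^ 2 = ε ^ 2 / (8 * Real.log (1 / δ)) := by
    rw [hbdef, scale, ← hN, div_pow, div_pow, mul_pow, mul_pow, Real.sq_sqrt (by positivity)]
    field_simp
    norm_num
  -- This is where `ε ≤ 8 log(1/δ)` enters: the mean loss takes at most half of `ε`, and the other
  -- half, squared over `2N(S/b)²`, gives exactly `log(1/δ)`.
  have hNe2 : N * (S / b) ^ 2 / 2 ≤ ε / 2 := by
    rw [hNe]
    have : ε ^ 2 / (8 * Real.log (1 / δ)) ≤ ε := by
      rw [div_le_iff₀ (by positivity), sq]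
      exact mul_le_mul_of_nonneg_left hεδ hε.le
    linarith
  refine pi_le_exp_mul_pi_add
    (L := fun ν x => (|x - F D' (latticePoint ν)| - |x - F D (latticePoint ν)|) / b) (e := S / b)
    (fun ν => by fun_prop) (by positivity) (fun ν x => ?_)
    (fun ν => map_laplace_eq_withDensity hb _ _) ?_ ?_ hA
  · rw [abs_div, abs_of_pos hb]
    refine div_le_div_of_nonneg_right ?_ hb.le
    refine (abs_abs_sub_abs_le_abs_sub _ _).trans ?_
    have : x - F D' (latticePoint ν) - (x - F D (latticePoint ν))
        = F D (latticePoint ν) - F D' (latticePoint ν) := by ring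
    rw [this]
    exact hdiff ν
  · rw [hcard]
    linarith
  · rw [hcard]
    rw [← Real.le_log_iff_exp_le hδ0]
    have h1 : (ε / 2) ^ 2 ≤ (ε - N * (S / b) ^ 2 / 2) ^ 2 :=
      pow_le_pow_left₀ (by linarith) (by linarith) 2
    have h2 : Real.log δ = -Real.log (1 / δ) := by rw [one_div, Real.log_inv, neg_neg]
    rw [h2, neg_div, neg_le_neg_iff, le_div_iff₀ (by positivity)]
    refine le_trans (le_of_eq ?_) h1
    rw [hNe]
    field_simp
    norm_num

/-! ### Accuracy of the mechanism -/

theorem isAccurate_mechanism {l : ℕ} (hl : 0 < l) {k h : ℕ} {b β η : ℝ} (hb : 0 < b)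
    (hβ0 : 0 < β) (hβ1 : β < 1) {X : Type*} {n : ℕ} {F : (Fin n → X) → (Fin l → ℝ) → ℝ}
    (happ : ∀ D, ∀ y ∈ cube l,
      |evaluate h (fun ν : Lattice l k => F D (latticePoint ν)) y - F D y| ≤ η) {α : ℝ}
    (hα : η + (2 ^ h) ^ l * (44 ^ l *
      (b * (2 * (Real.log 2 + (l * Real.log 4 + Real.log (1 / β)))))) ≤ α) :
    IsAccurate (mechanism F k b) (evaluate h) F α β := by
  intro D
  -- `Measure.le_map_apply` needs no measurability of the accuracy event, an uncountable
  -- intersection over `y`.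
  refine (le_pi_laplace_cell hl k hb hβ0 hβ1).trans ((measure_mono fun Z hZ => ?_).trans
    (Measure.le_map_apply (Measurable.aemeasurable (by fun_prop)) _))
  have hG : 0 ≤ b * (2 * (Real.log 2 + (l * Real.log 4 + Real.log (1 / β)))) := by
    have h1 : 0 ≤ Real.log (1 / β) := Real.log_nonneg ((one_le_div hβ0).2 hβ1.le)
    have h2 : 0 ≤ Real.log 2 := Real.log_nonneg (by norm_num)
    have h3 : 0 ≤ Real.log 4 := Real.log_nonneg (by norm_num)
    positivity
  have hnoise := abs_evaluate_le h (abs_evaluate_one_le_of_cell hG hZ)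
  intro y hy
  have h1 := evaluate_sub h (fun ν => F D (latticePoint ν) + Z ν)
    (fun ν : Lattice l k => F D (latticePoint ν)) y
  simp only [add_sub_cancel_left] at h1
  have h2 : evaluate h (fun ν => F D (latticePoint ν) + Z ν) y - F D y
      = (evaluate h (fun ν : Lattice l k => F D (latticePoint ν)) y - F D y) + evaluate h Z y := by
    rw [h1]
    ring
  rw [h2]
  exact (abs_add_le _ _).trans ((add_le_add (happ D y hy) (hnoise y hy)).trans hα)

/-- The cover size that balances an approximation error `k ^ (-p / 2)` and a noise of size
`k ^ (l / 2) * r`. -/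
noncomputable def coverSize (l : ℕ) (p r : ℝ) : ℕ := max 1 ⌈r ^ (-2 / ((l : ℝ) + p))⌉₊

theorem coverSize_pos (l : ℕ) (p r : ℝ) : 0 < coverSize l p r :=
  lt_of_lt_of_le one_pos (le_max_left _ _)

theorem coverSize_rpow_le (l : ℕ) {p r : ℝ} (hp : 0 < p) (hr : 0 < r) :
    (coverSize l p r : ℝ) ^ (-(p / 2)) ≤ r ^ (p / ((l : ℝ) + p)) := by
  have hlp : 0 < (l : ℝ) + p := by positivity
  have h1 : r ^ (-2 / ((l : ℝ) + p)) ≤ coverSize l p r := by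
    exact (Nat.le_ceil _).trans (Nat.cast_le.2 (le_max_right _ _))
  have h2 := Real.rpow_le_rpow_of_nonpos (Real.rpow_pos_of_pos hr _) h1
    (by linarith : -(p / 2) ≤ 0)
  refine h2.trans (le_of_eq ?_)
  rw [← Real.rpow_mul hr.le]
  congr 1
  field_simp

/-- If `r^(-2/(l+p)) ≥ 1`, the cover size has that order and the powers of `r` balance. Otherwise it
is bounded, and `r ≤ K` lets `r` itself be absorbed into `r^(p/(l+p))`. -/
theorem sqrt_coverSize_mul_le (l : ℕ) {p r K : ℝ} (hp : 0 < p) (hr : 0 < r) (hrK : r ≤ K) :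
    √(((coverSize l p r : ℝ) + 1) ^ l) * r
      ≤ 2 ^ l * (1 + max 1 K) * r ^ (p / ((l : ℝ) + p)) := by
  have hlp : 0 < (l : ℝ) + p := by positivity
  set q : ℝ := r ^ (-2 / ((l : ℝ) + p)) with hq
  have hq0 : 0 < q := Real.rpow_pos_of_pos hr _
  have h1 : (coverSize l p r : ℝ) + 1 ≤ 4 * max 1 q := by
    have h2 : (⌈q⌉₊ : ℝ) < q + 1 := Nat.ceil_lt_add_one hq0.le
    have h3 : (coverSize l p r : ℝ) = max 1 (⌈q⌉₊ : ℝ) := by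
      rw [coverSize]
      push_cast
      rfl
    have h4 : max 1 (⌈q⌉₊ : ℝ) ≤ max 1 q + 1 :=
      max_le (by linarith [le_max_left 1 q]) (by linarith [le_max_right 1 q])
    rw [h3]
    linarith [le_max_left 1 q]
  have h2 : √(((coverSize l p r : ℝ) + 1) ^ l) ≤ 2 ^ l * (1 + q ^ ((l : ℝ) / 2)) := by
    have h3 : √(((coverSize l p r : ℝ) + 1) ^ l) ≤ √((2 ^ l) ^ 2 * (max 1 q) ^ l) := by
      refine Real.sqrt_le_sqrt ((pow_le_pow_left₀ (by positivity) h1 l).trans (le_of_eq ?_))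
      rw [mul_pow, ← pow_mul, mul_comm l 2, pow_mul]
      norm_num
    rw [Real.sqrt_mul (by positivity), Real.sqrt_sq (by positivity)] at h3
    refine h3.trans (mul_le_mul_of_nonneg_left ?_ (by positivity))
    have h4 : ∀ x : ℝ, 0 ≤ x → √(x ^ l) = x ^ ((l : ℝ) / 2) := fun x hx => by
      rw [Real.sqrt_eq_rpow, ← Real.rpow_natCast, ← Real.rpow_mul hx]
      congr 1
      ring
    rw [h4 _ (by positivity)]
    rcases le_total 1 q with h | h
    · rw [max_eq_right h]
      linarith
    · rw [max_eq_left h, Real.one_rpow]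
      linarith [Real.rpow_nonneg hq0.le ((l : ℝ) / 2)]
  have h3 : q ^ ((l : ℝ) / 2) * r = r ^ (p / ((l : ℝ) + p)) := by
    rw [hq, ← Real.rpow_mul hr.le]
    nth_rewrite 2 [← Real.rpow_one r]
    rw [← Real.rpow_add hr]
    congr 1
    field_simp
    ring
  have h4 : r ≤ max 1 K * r ^ (p / ((l : ℝ) + p)) := by
    have h5 : r = r ^ ((l : ℝ) / ((l : ℝ) + p)) * r ^ (p / ((l : ℝ) + p)) := by
      rw [← Real.rpow_add hr, ← add_div, div_self hlp.ne', Real.rpow_one]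
    nth_rewrite 1 [h5]
    refine mul_le_mul_of_nonneg_right ?_ (by positivity)
    have h6 : (l : ℝ) / ((l : ℝ) + p) ≤ 1 := (div_le_one hlp).2 (by linarith)
    calc r ^ ((l : ℝ) / ((l : ℝ) + p)) ≤ (max 1 K) ^ ((l : ℝ) / ((l : ℝ) + p)) :=
          Real.rpow_le_rpow hr.le (hrK.trans (le_max_right _ _)) (by positivity)
      _ ≤ (max 1 K) ^ (1 : ℝ) := Real.rpow_le_rpow_of_exponent_le (le_max_left _ _) h6
      _ = _ := Real.rpow_one _
  calc _ ≤ 2 ^ l * (1 + q ^ ((l : ℝ) / 2)) * r := by gcongr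
    _ = 2 ^ l * (r + q ^ ((l : ℝ) / 2) * r) := by ring
    _ ≤ 2 ^ l * (max 1 K * r ^ (p / ((l : ℝ) + p)) + r ^ (p / ((l : ℝ) + p))) := by
        rw [h3]
        gcongr
    _ = _ := by ring

theorem scale_mul_log (l k : ℕ) (S ε δ β : ℝ) :
    scale l k S ε δ * Real.log (1 / β) = 2 * √2 * (√(((k : ℝ) + 1) ^ l) * rateBase S ε δ β) := by
  rw [scale, rateBase, Real.sqrt_mul (by positivity), Real.sqrt_mul (by norm_num)]
  ring

universe v in
/-- If the mechanism approximates a class of functions at rate `k ^ (-p / 2)`, then it is accurate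
on that class at rate `r ^ (p / (l + p))`. -/
theorem exists_isAccurate_mechanism {l : ℕ} (hl : 0 < l) (h : ℕ) {p : ℝ} (hp : 0 < p)
    {P : ((Fin l → ℝ) → ℝ) → Prop}
    (happ : ∃ C : ℝ, 0 ≤ C ∧ ∀ k : ℕ, 0 < k → ∀ f : (Fin l → ℝ) → ℝ, P f →
      ∀ y ∈ cube l, |evaluate h (fun ν : Lattice l k => f (latticePoint ν)) y - f y|
        ≤ C * (k : ℝ) ^ (-(p / 2)))
    {β₀ : ℝ} (hβ₀ : β₀ < 1) (K : ℝ) :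
    ∃ C : ℝ, 0 < C ∧ ∀ ε δ β : ℝ, 0 < ε → 0 < δ → δ < 1 → 0 < β → β ≤ β₀ →
      ∀ (X : Type v) (n : ℕ) (F : (Fin n → X) → (Fin l → ℝ) → ℝ) (S : ℝ), 0 < S →
        rateBase S ε δ β ≤ K → (∀ D, P (F D)) →
        IsAccurate (mechanism F (coverSize l p (rateBase S ε δ β))
            (scale l (coverSize l p (rateBase S ε δ β)) S ε δ)) (evaluate h) F
          (C * rateBase S ε δ β ^ (p / ((l : ℝ) + p))) β := by
  obtain ⟨C, hC0, hC⟩ := happ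
  set c : ℝ := 2 * (Real.log 2 + l * Real.log 4) with hc
  have hc0 : 0 ≤ c := by
    have h2 : 0 ≤ Real.log 2 := Real.log_nonneg (by norm_num)
    have h3 : 0 ≤ Real.log 4 := Real.log_nonneg (by norm_num)
    positivity
  -- Absorbs the additive constant `c` into `log(1/β) ≥ log(1/β₀) > 0`. The absolute value keeps `A`
  -- positive before `β₀ > 0` is known.
  set A : ℝ := c / |Real.log (1 / β₀)| + 2 with hA
  have hA0 : 0 < A := by positivity
  set B : ℝ := (2 ^ h) ^ l * (44 ^ l * (A * (2 * √2 * (2 ^ l * (1 + max 1 K))))) with hB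
  have hB0 : 0 < B := by positivity
  refine ⟨C + B, by positivity, fun ε δ β hε hδ0 hδ1 hβ0 hββ X n F S hS hrK hP => ?_⟩
  have hβ1 : β < 1 := hββ.trans_lt hβ₀
  have hlogδ : 0 < Real.log (1 / δ) := Real.log_pos ((one_lt_div hδ0).2 hδ1)
  have hlogβ : 0 < Real.log (1 / β) := Real.log_pos ((one_lt_div hβ0).2 hβ1)
  have hβ₀0 : 0 < β₀ := hβ0.trans_le hββ
  have hlogβ₀ : 0 < Real.log (1 / β₀) := Real.log_pos ((one_lt_div hβ₀0).2 hβ₀)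
  have hlogle : Real.log (1 / β₀) ≤ Real.log (1 / β) :=
    Real.log_le_log (by positivity) (one_div_le_one_div_of_le hβ0 hββ)
  set r := rateBase S ε δ β with hr
  have hr0 : 0 < r := by
    rw [hr, rateBase]
    positivity
  set k := coverSize l p r with hk
  have hb : 0 < scale l k S ε δ := by
    rw [scale]
    positivity
  refine isAccurate_mechanism hl hb hβ0 hβ1 (fun D => hC k (coverSize_pos l p r) (F D) (hP D)) ?_
  rw [add_mul]
  refine add_le_add (mul_le_mul_of_nonneg_left (coverSize_rpow_le l hp hr0) hC0) ?_
  have h1 : 2 * (Real.log 2 + (l * Real.log 4 + Real.log (1 / β))) ≤ A * Real.log (1 / β) := by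
    have h2 : c ≤ c / |Real.log (1 / β₀)| * Real.log (1 / β) := by
      rw [abs_of_pos hlogβ₀, div_mul_eq_mul_div, le_div_iff₀ hlogβ₀]
      exact mul_le_mul_of_nonneg_left hlogle hc0
    rw [hA]
    linarith
  have h3 : scale l k S ε δ * (2 * (Real.log 2 + (l * Real.log 4 + Real.log (1 / β))))
      ≤ A * (2 * √2 * (2 ^ l * (1 + max 1 K))) * r ^ (p / ((l : ℝ) + p)) := by
    calc _ ≤ scale l k S ε δ * (A * Real.log (1 / β)) := by gcongr
      _ = A * (2 * √2 * (√(((k : ℝ) + 1) ^ l) * r)) := by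
          rw [hr, ← scale_mul_log]
          ring
      _ ≤ A * (2 * √2 * (2 ^ l * (1 + max 1 K) * r ^ (p / ((l : ℝ) + p)))) := by
          have := sqrt_coverSize_mul_le l hp hr0 hrK
          gcongr
      _ = _ := by ring
  calc _ ≤ (2 ^ h) ^ l * (44 ^ l *
        (A * (2 * √2 * (2 ^ l * (1 + max 1 K))) * r ^ (p / ((l : ℝ) + p)))) := by gcongr
    _ = _ := by
        rw [hB]
        ring

end BernsteinMechanism

theorem mainTheorem2 (l : ℕ) (hl : 0 < l) :
    -- privacy, for every cover size and every `F` of finite sensitivity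
    (∀ (ε δ : ℝ), 0 < ε → 0 < δ → δ < 1 → ε ≤ 8 * Real.log (1 / δ) →
      ∀ (X : Type u) (n : ℕ) (F : (Fin n → X) → (Fin l → ℝ) → ℝ), sensitivity F ≠ ⊤ →
      ∀ k : ℕ, 0 < k →
        IsDifferentiallyPrivate (mechanism F k (scale l k (sensitivity F).toReal ε δ)) ε δ) ∧
    -- accuracy, smooth case
    (∀ (h : ℕ), 0 < h → ∀ T : ℝ, 0 < T →
      ∃ k : ℝ → ℝ → ℝ → ℝ → ℕ, (∀ S ε δ β, 0 < k S ε δ β) ∧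
      ∀ β₀ : ℝ, β₀ < 1 → ∀ K : ℝ, ∃ C : ℝ, 0 < C ∧
      ∀ (ε δ β : ℝ), 0 < ε → 0 < δ → δ < 1 → 0 < β → β ≤ β₀ →
      ∀ (X : Type u) (n : ℕ) (F : (Fin n → X) → (Fin l → ℝ) → ℝ) (S : ℝ), 0 < S →
        sensitivity F = ENNReal.ofReal S → rateBase S ε δ β ≤ K →
        (∀ D, IsSmooth (2 * h) T (F D)) →
        IsAccurate (mechanism F (k S ε δ β) (scale l (k S ε δ β) S ε δ)) (evaluate h) F
          (C * rateBase S ε δ β ^ (2 * (h : ℝ) / ((l : ℝ) + 2 * (h : ℝ)))) β) ∧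
    -- accuracy, Hölder case
    (∀ (γ L : ℝ), 0 < γ → γ ≤ 1 → 0 < L →
      ∃ k : ℝ → ℝ → ℝ → ℝ → ℕ, (∀ S ε δ β, 0 < k S ε δ β) ∧
      ∀ (h : ℕ), 0 < h → ∀ β₀ : ℝ, β₀ < 1 → ∀ K : ℝ, ∃ C : ℝ, 0 < C ∧
      ∀ (ε δ β : ℝ), 0 < ε → 0 < δ → δ < 1 → 0 < β → β ≤ β₀ →
      ∀ (X : Type u) (n : ℕ) (F : (Fin n → X) → (Fin l → ℝ) → ℝ) (S : ℝ), 0 < S →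
        sensitivity F = ENNReal.ofReal S → rateBase S ε δ β ≤ K →
        (∀ D, IsHolder γ L (F D)) →
        IsAccurate (mechanism F (k S ε δ β) (scale l (k S ε δ β) S ε δ)) (evaluate h) F
          (C * rateBase S ε δ β ^ (γ / ((l : ℝ) + γ))) β) := by
  refine ⟨fun ε δ hε hδ0 hδ1 hεδ X n F hF k _ =>
    isDifferentiallyPrivate_mechanism hε hδ0 hδ1 hεδ hF k, fun h hh T hT => ?_,
    fun γ L h0 h1 hL => ?_⟩
  · refine ⟨fun S ε δ β => coverSize l (2 * h) (rateBase S ε δ β),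
      fun S ε δ β => coverSize_pos _ _ _, fun β₀ hβ₀ K => ?_⟩
    obtain ⟨C, hC0, hC⟩ := exists_isAccurate_mechanism.{u} hl h (by positivity)
      (exists_abs_evaluate_sub_le_of_isSmooth l hh hT) hβ₀ K
    exact ⟨C, hC0, fun ε δ β hε hδ0 hδ1 hβ0 hββ X n F S hS _ hrK hF =>
      hC ε δ β hε hδ0 hδ1 hβ0 hββ X n F S hS hrK hF⟩
  -- The balance involves `γ` but not the order, so the cover size can be fixed before `h`.
  · refine ⟨fun S ε δ β => coverSize l γ (rateBase S ε δ β),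
      fun S ε δ β => coverSize_pos _ _ _, fun h hh β₀ hβ₀ K => ?_⟩
    obtain ⟨C, hC0, hC⟩ := exists_isAccurate_mechanism.{u} hl h h0
      (exists_abs_evaluate_sub_le_of_isHolder l hh h0 h1 hL) hβ₀ K
    exact ⟨C, hC0, fun ε δ β hε hδ0 hδ1 hβ0 hββ X n F S hS _ hrK hF =>
      hC ε δ β hε hδ0 hδ1 hβ0 hββ X n F S hS hrK hF⟩
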